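/- Let $n\ge 0$ and $\hbar,\tau,\varsigma>0$. Write $\langle f,g\rangle=\int f\bar g$, let $[\rho(s,x,y)f](t)=e^{\pi i\hbar(2s-2y\cdot t+x\cdot y)}f(t-x)$ be the Schrödinger representation of the Heisenberg group on $L^2(\mathbb R^n)$, and let $\phi_\tau(t)=(2\hbar/\tau)^{n/4}e^{-\pi\hbar|t|^2/\tau}$ be the unit squeezed Gaussian. Let $U_\tau f(x,y)=\hbar^{n/2}\langle f,\rho(0,x,y)\phi_\tau\rangle$ be the pre-FSB transform and let $\mathcal F_\tau\subset L^2(\mathbb R^{2n})$ be the pre-FSB space, i.e. the closed linear span of all $U_\tau f$, $f\in L^2(\mathbb R^n)$. Let $P_\tau$ be the orthogonal projection of $L^2(\mathbb R^{2n})$ onto $\mathcal F_\tau$. The mixed Gaussian is $\Phi_{\tau\varsigma}(x,y)=\langle\phi_\varsigma,\rho(0,x,y)\phi_\tau\rangle$. For a tempered symbol $a$ on $\mathbb R^{2n}$, the Weyl pseudodifferential operator is $a(D,X)=\int\hat a(x,y)\,\rho(0,x,y)\,dx\,dy$ (in the weak sense), where $\hat u(x,y)=(\hbar/2)^n\int u(x',y')e^{\pi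 i\hbar(x'\cdot y-y'\cdot x)}dx'dy'$ is the symplectic Fourier transform (taken in the sense of tempered distributions for $a$). That is, for Schwartz functions $f,g$ on $\mathbb R^n$, $$\langle a(D,X)f,g\rangle=\int_{\mathbb R^{2n}}a(z)\,\hat u(-z)\,dz,\qquad u(x,y)=\langle\rho(0,x,y)f,g\rangle .$$ For $f,h\in L^2(\mathbb R^n)$, the equality $a(D,X)f=h$ means that for every Schwartz $g$, $\langle a(D,X)\varphi,g\rangle\to\langle h,g\rangle$ as Schwartz functions $\varphi$ tend to $f$ in $L^2(\mathbb R^n)$. Let $\psi$ be a measurable function on $\mathbb R^{2n}$ with $(1+|z|)^{-N}\psi\in L^2(\mathbb R^{2n})$ for some $N\in\mathbb N$ (for example, any measurable function of at most polynomial growth, in particular any bounded one). The cross-Toeplitz operator $T_\psi=P_\varsigma\psi I:\mathcal F_\tau\to\mathcal F_\varsigma$, $T_\psi F=P_\varsigma(\psi F)$, has the domain $\{F\in\mathcal F_\tau:\psi F\in L^2(\mathbb R^{2n})\}$ (all of $\mathcal F_\tau$ if $\psi$ is bounded). **Proposition.** $T_\psi$ is unitarily equivalent, through the pre-FSB transforms,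 to the Weyl pseudodifferential operator $a_\psi(D,X)$ on $\mathbb R^n$ with the symbol $$a_\psi(x,y)=\hbar^{2n}\int_{\mathbb R^{2n}}\psi(x',y')\,\Phi_{\tau\varsigma}(x-2x',y-2y')\,dx'\,dy',$$ where $$\Phi_{\tau\varsigma}(x,y)=\Big(\frac{4\tau\varsigma}{(\tau+\varsigma)^2}\Big)^{n/4}\exp\Big(-\frac{\pi\hbar}{\tau+\varsigma}\big(i(\tau-\varsigma)\,x\cdot y+|x|^2+\tau\varsigma|y|^2\big)\Big).$$ More precisely: the integral for $a_\psi(z)$ converges absolutely for every $z$, and so does the integral for $\langle a_\psi(D,X)f,g\rangle$ for all Schwartz $f,g$; $U_\tau$ and $U_\varsigma$ are unitary maps of $L^2(\mathbb R^n)$ onto $\mathcal F_\tau$ and $\mathcal F_\varsigma$; the domain of $T_\psi$ contains $U_\tau\varphi$ for every Schwartz function $\varphi$; and for every $f\in L^2(\mathbb R^n)$ such that $U_\tau f$ is in the domain of $T_\psi$, $$U_\varsigma^{-1}\,T_\psi\,U_\tau f=a_\psi(D,X)f .$$ -/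

import Mathlib

open MeasureTheory Filter Topology
open scoped SchwartzMap RealInnerProductSpace ENNReal ComplexConjugate

noncomputable section

/-- The configuration space `ℝⁿ`. -/
abbrev Config (n : ℕ) : Type := EuclideanSpace ℝ (Fin n)

/-- The phase space `ℝ²ⁿ` of points `(x, y)`, with Lebesgue measure. -/
abbrev Phase (n : ℕ) : Type := Config n × Config n

/-- `L²(ℝⁿ)`. -/
abbrev L2Config (n : ℕ) : Type := Lp ℂ 2 (volume : Measure (Config n))

/-- `L²(ℝ²ⁿ)`. -/
abbrev L2Phase (n : ℕ) : Type := Lp ℂ 2 (volume : Measure (Phase n))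

variable {n : ℕ}

/-- The Schrödinger representation of the Heisenberg group:
`[ρ(s,x,y)f](t) = exp(πiħ(2s - 2yt + xy)) f(t - x)`. -/
def schrodinger (hbar s : ℝ) (x y : Config n) (f : Config n → ℂ) (t : Config n) : ℂ :=
  Complex.exp (Real.pi * Complex.I * hbar * ((2 * s - 2 * ⟪y, t⟫ + ⟪x, y⟫ : ℝ) : ℂ)) * f (t - x)

/-- The matrix coefficient (Fourier-Wigner transform) `W(f,φ)(x,y) = ⟨f, ρ(0,x,y)φ⟩`, where
`⟨f, g⟩ = ∫ f(t) conj(g(t)) dt`. -/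
def fourierWigner (hbar : ℝ) (f φ : Config n → ℂ) (z : Phase n) : ℂ :=
  ∫ t, f t * conj (schrodinger hbar 0 z.1 z.2 φ t)

/-- The squeezed Gaussian `exp(-πħ|t|²/τ)`, normalised to be a unit vector of `L²(ℝⁿ)`. -/
def vacuum (hbar τ : ℝ) (t : Config n) : ℂ :=
  (((2 * hbar / τ) ^ ((n : ℝ) / 4) * Real.exp (-(Real.pi * hbar * ‖t‖ ^ 2 / τ)) : ℝ) : ℂ)

/-- The pre-FSB (coherent state) transform `f ↦ ħ^{n/2} ⟨f, ρ(0,x,y)φ_τ⟩`. The factor `ħ^{n/2}`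
makes it isometric for Lebesgue measure on the phase space. -/
def preFSB (hbar τ : ℝ) (f : Config n → ℂ) (z : Phase n) : ℂ :=
  ((hbar ^ ((n : ℝ) / 2) : ℝ) : ℂ) * fourierWigner hbar f (vacuum hbar τ) z

/-- The mixed Gaussian `Φ_{τς}(x,y) = ⟨φ_ς, ρ(0,x,y)φ_τ⟩`. -/
def mixedGaussian (hbar τ ς : ℝ) (z : Phase n) : ℂ :=
  fourierWigner hbar (vacuum hbar ς) (vacuum hbar τ) z

/-- The pre-FSB space `F_τ`: the closed linear span in `L²(ℝ²ⁿ)` of the pre-FSB transforms of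
functions in `L²(ℝⁿ)`. (Since the transform is linear and isometric, every element of this
space is itself a transform; this is not built into the definition.) -/
def fsbSpace (n : ℕ) (hbar τ : ℝ) : Submodule ℂ (L2Phase n) :=
  (Submodule.span ℂ
    {F : L2Phase n | ∃ f : L2Config n, F =ᵐ[volume] preFSB hbar τ f}).topologicalClosure

instance fsbSpace.instCompleteSpace (n : ℕ) (hbar τ : ℝ) : CompleteSpace (fsbSpace n hbar τ) :=
  (Submodule.isClosed_topologicalClosure _).completeSpace_coe

/-- The natural domain `{F ∈ L²(ℝ²ⁿ) | ψF ∈ L²(ℝ²ⁿ)}` of multiplication by `ψ`. -/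
def mulDomain (ψ : Phase n → ℂ) : Submodule ℂ (L2Phase n) where
  carrier := {F | MemLp (fun z => ψ z * F z) 2 volume}
  zero_mem' := by
    refine MemLp.ae_eq (f := fun _ => (0 : ℂ)) ?_ MemLp.zero'
    filter_upwards [Lp.coeFn_zero ℂ 2 (volume : Measure (Phase n))] with z hz
    rw [hz, Pi.zero_apply, mul_zero]
  add_mem' := by
    intro F G hF hG
    refine MemLp.ae_eq ?_ (MemLp.add hF hG)
    filter_upwards [Lp.coeFn_add F G] with z hz
    rw [hz, Pi.add_apply, Pi.add_apply, mul_add]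
  smul_mem' := by
    intro c F hF
    refine MemLp.ae_eq ?_ (MemLp.const_smul hF c)
    filter_upwards [Lp.coeFn_smul c F] with z hz
    rw [hz, Pi.smul_apply, Pi.smul_apply, smul_eq_mul, smul_eq_mul, mul_left_comm]

theorem mem_mulDomain {ψ : Phase n → ℂ} {F : L2Phase n} :
    F ∈ mulDomain ψ ↔ MemLp (fun z => ψ z * F z) 2 volume := Iff.rfl

/-- The operator `ψI` of multiplication by `ψ` in `L²(ℝ²ⁿ)`, on its natural domain. -/
def mulOperator (ψ : Phase n → ℂ) : L2Phase n →ₗ.[ℂ] L2Phase n where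
  domain := mulDomain ψ
  toFun :=
    { toFun := fun F => MemLp.toLp (fun z => ψ z * (F : L2Phase n) z) (mem_mulDomain.1 F.2)
      map_add' := by
        rintro ⟨F, hF⟩ ⟨G, hG⟩
        refine (MemLp.toLp_congr _ ((mem_mulDomain.1 hF).add (mem_mulDomain.1 hG)) ?_).trans
          (MemLp.toLp_add (mem_mulDomain.1 hF) (mem_mulDomain.1 hG))
        filter_upwards [Lp.coeFn_add F G] with z hz
        simp only [Submodule.coe_add, Pi.add_apply]
        rw [hz, Pi.add_apply, mul_add]
      map_smul' := by
        rintro c ⟨F, hF⟩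
        refine (MemLp.toLp_congr _ ((mem_mulDomain.1 hF).const_smul c) ?_).trans
          (MemLp.toLp_const_smul c (mem_mulDomain.1 hF))
        filter_upwards [Lp.coeFn_smul c F] with z hz
        simp only [Submodule.coe_smul, Pi.smul_apply]
        rw [hz, Pi.smul_apply, smul_eq_mul, smul_eq_mul, mul_left_comm] }

/-- The cross-Toeplitz operator `T_ψ F = P_ς(ψF)` from `F_τ` to `F_ς`, where `P_ς` is the
orthogonal projection of `L²(ℝ²ⁿ)` onto `F_ς`, on its natural domain
`{F ∈ F_τ | ψF ∈ L²(ℝ²ⁿ)}`. -/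
def crossToeplitz (n : ℕ) (hbar τ ς : ℝ) (ψ : Phase n → ℂ) :
    fsbSpace n hbar τ →ₗ.[ℂ] fsbSpace n hbar ς where
  domain := (mulOperator ψ).domain.comap (fsbSpace n hbar τ).subtype
  toFun := ((fsbSpace n hbar ς).orthogonalProjectionOnto : L2Phase n →ₗ[ℂ] fsbSpace n hbar ς) ∘ₗ
    (mulOperator ψ).toFun ∘ₗ (fsbSpace n hbar τ).subtype.restrict (fun _ h => h)

/-- The symplectic Fourier transform
`û(x,y) = (ħ/2)ⁿ ∫ u(x',y') exp(πiħ(x'y - y'x)) dx' dy'`. -/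
def symplecticFourier (hbar : ℝ) (u : Phase n → ℂ) (z : Phase n) : ℂ :=
  (((hbar / 2) ^ n : ℝ) : ℂ) *
    ∫ w : Phase n, u w *
      Complex.exp (Real.pi * Complex.I * hbar * ((⟪w.1, z.2⟫ - ⟪w.2, z.1⟫ : ℝ) : ℂ))

/-- The function `(x,y) ↦ ⟨ρ(0,x,y)f, g⟩` on the phase space. -/
def schrodingerCoeff (hbar : ℝ) (f g : Config n → ℂ) (z : Phase n) : ℂ :=
  ∫ t, schrodinger hbar 0 z.1 z.2 f t * conj (g t)

/-- The sesquilinear form of the Weyl pseudodifferential operator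
`a(D,X) = ρ(â) = ∫ â(x,y) ρ(0,x,y) dx dy` on Schwartz functions. The integral is taken in the weak
sense, and `â` is the symplectic Fourier transform of `a` as a tempered distribution, so it is
evaluated on the coefficient `u = ⟨ρ(·)f, g⟩` by `∫ â(z) u(z) dz = ∫ a(z) û(-z) dz`. -/
def weylForm (hbar : ℝ) (a : Phase n → ℂ) (f g : Config n → ℂ) : ℂ :=
  ∫ z : Phase n, a z * symplecticFourier hbar (schrodingerCoeff hbar f g) (-z)

/-- `a(D,X) f = h` for `f, h ∈ L²(ℝⁿ)`, in the sense of tempered distributions: for every Schwartz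
function `g` one has `⟨a(D,X)φ, g⟩ → ⟨h, g⟩` as Schwartz functions `φ` tend to `f` in `L²(ℝⁿ)`.
If `f` is itself a Schwartz function, this contains `⟨a(D,X)f, g⟩ = ⟨h, g⟩`.
(Mathlib's `inner ℂ g h` is linear in `h`, and equals `∫ h conj(g)`.) -/
def IsWeylPDO (hbar : ℝ) (a : Phase n → ℂ) (f h : L2Config n) : Prop :=
  ∀ g : 𝓢(Config n, ℂ),
    Tendsto (fun φ : 𝓢(Config n, ℂ) => weylForm hbar a φ g)
      (comap (fun φ : 𝓢(Config n, ℂ) => φ.toLp 2 volume) (𝓝 f))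
      (𝓝 (inner ℂ (g.toLp 2 volume) h))

/-- The symbol `a_ψ(z) = ħ²ⁿ ∫ ψ(w) Φ_{τς}(z - 2w) dw`. -/
def toeplitzSymbol (hbar τ ς : ℝ) (ψ : Phase n → ℂ) (z : Phase n) : ℂ :=
  ((hbar ^ (2 * n) : ℝ) : ℂ) * ∫ w : Phase n, ψ w * mixedGaussian hbar τ ς (z - (2 : ℝ) • w)

end

/-! Write W for the transform `fourierWigner`. Everything rests on evaluating the Weyl form of one
translated Gaussian. For u = ⟨ρ(·)f, g⟩ the function û(-z) is a Wigner transform. It is covariant: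
replacing z by z + 2w amounts to replacing f, g by ρ(0,-w)f, ρ(0,-w)g
(`symplecticFourier_schrodingerCoeff_add`), which is where the 2 in Φ(z - 2w) comes from. Moyal's
identity then turns ∫ Φ(z - 2w) û(-z) dz into the rank-one quantity ħ⁻ⁿ W(f,φ_τ)(w) conj W(g,φ_ς)(w)
(`integral_mixedGaussian_mul_symplecticFourier`). Integrating against ħ²ⁿψ(w), Fubini gives the Weyl
form ∫ ψ U_τf conj(U_ςg) (`weylForm_toeplitzSymbol`). Since U_ςg lies in F_ς, the projection P_ς
drops out of ⟨P_ς ψ U_τf, U_ςg⟩, which is the same integral.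

The analysis is reduced to the cross-ambiguity function, a partial Fourier transform of f(t)g(t -
x). Up to a unimodular phase, a scaling of y and conjugations or a reflection of its arguments, it
is the matrix coefficient, the transform U_τ and û alike. Hence one decay estimate
(`exists_norm_ambiguity_le`) and one Moyal identity (`integral_ambiguity_mul_conj`) suffice. Moyal
also makes U_τ isometric; rapid decay against the polynomial weight on ψ gives all the absolute
convergence. -/

noncomputable section

/-! ### Gaussians as Schwartz functions -/

section Prelim

variable {E : Type*} [NormedAddCommGroup E] [InnerProductSpace ℝ E]

theorem iteratedDeriv_cexp_mul_ofReal (a : ℂ) (m : ℕ) :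
    iteratedDeriv m (fun s : ℝ => Complex.exp (a * s)) =
      fun s : ℝ => a ^ m * Complex.exp (a * s) := by
  induction m with
  | zero => simp
  | succ m ih =>
    rw [iteratedDeriv_succ, ih]
    funext s
    have h : HasDerivAt (fun s : ℝ => Complex.exp (a * s)) (Complex.exp (a * s) * (a * 1)) s :=
      (((hasDerivAt_id (s : ℂ)).const_mul a).cexp).comp_ofReal
    rw [(h.const_mul (a ^ m)).deriv]
    ring

theorem contDiff_cexp_mul_ofReal (a : ℂ) {m : WithTop ℕ∞} :
    ContDiff ℝ m (fun s : ℝ => Complex.exp (a * s)) :=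
  (contDiff_const.mul Complex.ofRealCLM.contDiff).cexp

theorem hasTemperateGrowth_cexp_mul_I (c : ℝ) :
    (fun s : ℝ => Complex.exp (c * Complex.I * s)).HasTemperateGrowth := by
  refine ⟨contDiff_cexp_mul_ofReal _, fun m => ⟨0, |c| ^ m, fun s => ?_⟩⟩
  rw [norm_iteratedFDeriv_eq_norm_iteratedDeriv, iteratedDeriv_cexp_mul_ofReal]
  simp [Complex.norm_exp]

/-- Characters of a Euclidean space are functions of temperate growth. -/
theorem hasTemperateGrowth_cexp_inner (c : ℝ) (y : E) :
    (fun t : E => Complex.exp (c * Complex.I * (⟪y, t⟫ : ℝ))).HasTemperateGrowth :=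
  (hasTemperateGrowth_cexp_mul_I c).comp (innerSL ℝ y).hasTemperateGrowth

theorem exists_one_add_pow_mul_exp_neg_sq_le {c : ℝ} (hc : 0 < c) (M : ℕ) :
    ∃ K : ℝ, 0 ≤ K ∧ ∀ r : ℝ, 0 ≤ r → (1 + r) ^ M * Real.exp (-(c * r ^ 2)) ≤ K := by
  -- The bound (1 + r)^M ≤ M! exp(1 + r) leaves the exponent 1 + r - cr², whose maximum is 1 +
  -- 1/(4c).
  refine ⟨M.factorial * Real.exp (1 + 1 / (4 * c)), by positivity, fun r hr => ?_⟩
  have h1 : (1 + r) ^ M ≤ M.factorial * Real.exp (1 + r) := by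
    have := Real.pow_div_factorial_le_exp (1 + r) (by positivity) M
    rwa [div_le_iff₀' (by positivity)] at this
  calc (1 + r) ^ M * Real.exp (-(c * r ^ 2))
      ≤ M.factorial * Real.exp (1 + r) * Real.exp (-(c * r ^ 2)) := by gcongr
    _ = M.factorial * Real.exp (1 + r - c * r ^ 2) := by
        rw [mul_assoc, ← Real.exp_add, sub_eq_add_neg]
    _ ≤ _ := by
        gcongr
        have : c * (r - 1 / (2 * c)) ^ 2 = c * r ^ 2 - r + 1 / (4 * c) := by
          field_simp
          ring
        have h2 : 0 ≤ c * (r - 1 / (2 * c)) ^ 2 := by positivity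
        linarith

/-- The Gaussian is s ↦ exp(-s) composed with a quadratic of temperate growth, so the chain-rule
bound costs only a polynomial factor, which the Gaussian absorbs. Writing the exponent as `-1 * _`
matches `iteratedDeriv_cexp_mul_ofReal`. -/
theorem decay_gaussian {c : ℝ} (hc : 0 < c) (k m : ℕ) :
    ∃ C : ℝ, ∀ t : E, ‖t‖ ^ k *
      ‖iteratedFDeriv ℝ m (fun t : E => Complex.exp (-1 * ((c * ‖t‖ ^ 2 : ℝ) : ℂ))) t‖ ≤ C := by
  have hf : (fun t : E => c * ‖t‖ ^ 2).HasTemperateGrowth := by fun_prop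
  obtain ⟨l, C, hC0, hC⟩ := hf.norm_iteratedFDeriv_le_uniform m
  obtain ⟨K, hK0, hK⟩ := exists_one_add_pow_mul_exp_neg_sq_le hc (k + l * m)
  refine ⟨m.factorial * (1 + C) ^ m * K, fun t => ?_⟩
  -- The chain-rule bound requires the form D^i. Enlarging C to 1 + C makes D at least 1, hence at
  -- most D^i.
  have h1 : ∀ i, 1 ≤ i → i ≤ m → ‖iteratedFDeriv ℝ i (fun t : E => c * ‖t‖ ^ 2) t‖ ≤
      ((1 + C) * (1 + ‖t‖) ^ l) ^ i := by
    intro i hi him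
    have ht : 1 ≤ (1 + ‖t‖) ^ l := one_le_pow₀ (by linarith [norm_nonneg t])
    calc _ ≤ C * (1 + ‖t‖) ^ l := hC i him t
      _ ≤ (1 + C) * (1 + ‖t‖) ^ l := by gcongr; linarith
      _ ≤ _ := le_self_pow₀ (by nlinarith) (by omega)
  have h2 := norm_iteratedFDeriv_comp_le (𝕜 := ℝ) (contDiff_cexp_mul_ofReal (-1)) hf.1
    (n := m) (N := (⊤ : ℕ∞)) (by exact_mod_cast le_top) t
    (C := Real.exp (-(c * ‖t‖ ^ 2))) (D := (1 + C) * (1 + ‖t‖) ^ l) (fun i _ => by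
      rw [norm_iteratedFDeriv_eq_norm_iteratedDeriv, iteratedDeriv_cexp_mul_ofReal]
      simp only [norm_mul, norm_pow, norm_neg, norm_one, one_pow, one_mul, Complex.norm_exp]
      apply le_of_eq
      congr 1
      rw [neg_one_mul, Complex.neg_re, Complex.ofReal_re]) h1
  calc _ ≤ (1 + ‖t‖) ^ k * (m.factorial * Real.exp (-(c * ‖t‖ ^ 2)) *
        ((1 + C) * (1 + ‖t‖) ^ l) ^ m) := by
        gcongr
        · linarith
        · exact h2
    _ = m.factorial * (1 + C) ^ m *
        ((1 + ‖t‖) ^ (k + l * m) * Real.exp (-(c * ‖t‖ ^ 2))) := by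
        rw [mul_pow, ← pow_mul, pow_add]; ring
    _ ≤ _ := by gcongr; exact hK _ (norm_nonneg t)

/-- The Gaussian `exp(-c|t|²)` as a Schwartz function. -/
def gaussianSchwartz {c : ℝ} (hc : 0 < c) : 𝓢(E, ℂ) where
  toFun t := Complex.exp (-1 * ((c * ‖t‖ ^ 2 : ℝ) : ℂ))
  smooth' := (contDiff_cexp_mul_ofReal (-1)).comp
    ((contDiff_const (c := c)).mul (contDiff_norm_sq ℝ))
  decay' := decay_gaussian hc

end Prelim

/-! ### The Schrödinger representation on Schwartz functions -/

/-- The unit squeezed Gaussian as a Schwartz function. -/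
def vacuumS (n : ℕ) {hbar τ : ℝ} (hh : 0 < hbar) (hτ : 0 < τ) : 𝓢(Config n, ℂ) :=
  (((2 * hbar / τ) ^ ((n : ℝ) / 4) : ℝ) : ℂ) •
    gaussianSchwartz (show 0 < Real.pi * hbar / τ by positivity)

theorem coe_vacuumS {hbar τ : ℝ} (hh : 0 < hbar) (hτ : 0 < τ) :
    (vacuumS n hh hτ : Config n → ℂ) = vacuum hbar τ := by
  funext t
  simp only [vacuumS, vacuum, smul_apply, smul_eq_mul, Complex.ofReal_mul,
    Complex.ofReal_exp]
  congr 1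
  change Complex.exp _ = _
  congr 1
  push_cast
  ring

/-- Complex conjugate of a Schwartz function. -/
def conjS (f : 𝓢(Config n, ℂ)) : 𝓢(Config n, ℂ) :=
  f.postcompCLM (Complex.conjCLE : ℂ →L[ℝ] ℂ)

@[simp] theorem conjS_apply (f : 𝓢(Config n, ℂ)) (t : Config n) : conjS f t = conj (f t) := rfl

/-- The reflection `t ↦ f(-t)` of a Schwartz function. -/
def reflectS (f : 𝓢(Config n, ℂ)) : 𝓢(Config n, ℂ) :=
  SchwartzMap.compCLMOfContinuousLinearEquiv ℂ (ContinuousLinearEquiv.neg ℝ) f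

@[simp] theorem reflectS_apply (f : 𝓢(Config n, ℂ)) (t : Config n) : reflectS f t = f (-t) := rfl

/-- The Schrödinger representation on Schwartz functions. -/
def schrodingerS (hbar : ℝ) (z : Phase n) (f : 𝓢(Config n, ℂ)) : 𝓢(Config n, ℂ) :=
  Complex.exp (Real.pi * Complex.I * hbar * (⟪z.1, z.2⟫ : ℝ)) •
    SchwartzMap.smulLeftCLM ℂ
      (fun t => Complex.exp ((-2 * Real.pi * hbar : ℝ) * Complex.I * (⟪z.2, t⟫ : ℝ)))
      (SchwartzMap.compSubConstCLM ℂ z.1 f)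

theorem coe_schrodingerS (hbar : ℝ) (z : Phase n) (f : 𝓢(Config n, ℂ)) :
    (schrodingerS hbar z f : Config n → ℂ) = schrodinger hbar 0 z.1 z.2 f := by
  funext t
  simp only [schrodingerS, schrodinger, smul_apply, smul_eq_mul,
    SchwartzMap.smulLeftCLM_apply_apply (hasTemperateGrowth_cexp_inner _ _),
    SchwartzMap.compSubConstCLM_apply]
  rw [← mul_assoc, ← Complex.exp_add]
  congr 2
  push_cast
  ring

/-! ### Decay of the cross-ambiguity function -/

/-- The Schwartz function `t ↦ f(t) g(t - x)`. -/
def windowS (f g : 𝓢(Config n, ℂ)) (x : Config n) : 𝓢(Config n, ℂ) :=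
  SchwartzMap.pairing (ContinuousLinearMap.mul ℂ ℂ) f (SchwartzMap.compSubConstCLM ℂ x g)

@[simp] theorem windowS_apply (f g : 𝓢(Config n, ℂ)) (x t : Config n) :
    windowS f g x t = f t * g (t - x) := rfl

theorem SchwartzMap.exists_one_add_pow_mul_norm_iteratedFDeriv_le (f : 𝓢(Config n, ℂ)) (k m : ℕ) :
    ∃ C : ℝ, 0 ≤ C ∧ ∀ i ≤ m, ∀ t, (1 + ‖t‖) ^ k * ‖iteratedFDeriv ℝ i f t‖ ≤ C := by
  refine ⟨2 ^ k * (Finset.Iic (k, m)).sup (fun m => SchwartzMap.seminorm ℝ m.1 m.2) f,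
    mul_nonneg (by positivity) (apply_nonneg _ _), fun i hi t =>
      SchwartzMap.one_add_le_sup_seminorm_apply (𝕜 := ℝ) (m := (k, m)) le_rfl hi f t⟩

/-- A Peetre-type inequality: it trades decay in t and in t - x for decay in x. -/
theorem one_add_norm_le_mul_sub {E : Type*} [SeminormedAddCommGroup E] (x t : E) :
    1 + ‖x‖ ≤ (1 + ‖t‖) * (1 + ‖t - x‖) := by
  have h : ‖x‖ ≤ ‖t‖ + ‖t - x‖ := by
    calc ‖x‖ = ‖t - (t - x)‖ := by rw [sub_sub_cancel]
      _ ≤ _ := norm_sub_le _ _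
  nlinarith [norm_nonneg t, norm_nonneg (t - x), mul_nonneg (norm_nonneg t) (norm_nonneg (t - x))]

/-- In the Leibniz expansion f supplies k + l powers of decay and g supplies k. The k shared powers
become decay in x, uniformly in t. -/
theorem exists_norm_iteratedFDeriv_windowS_le (f g : 𝓢(Config n, ℂ)) (k l m : ℕ) :
    ∃ C : ℝ, 0 ≤ C ∧ ∀ j ≤ m, ∀ x t,
      (1 + ‖x‖) ^ k * ((1 + ‖t‖) ^ l * ‖iteratedFDeriv ℝ j (windowS f g x) t‖) ≤ C := by
  obtain ⟨C₁, hC₁, h₁⟩ := f.exists_one_add_pow_mul_norm_iteratedFDeriv_le (k + l) m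
  obtain ⟨C₂, hC₂, h₂⟩ := g.exists_one_add_pow_mul_norm_iteratedFDeriv_le k m
  -- The Leibniz binomial coefficients sum to 2^j, at most 2^m.
  refine ⟨2 ^ m * (C₁ * C₂), by positivity, fun j hj x t => ?_⟩
  have hb := norm_iteratedFDeriv_mul_le (𝕜 := ℝ) (N := (⊤ : ℕ∞)) (f.smooth ⊤)
    ((g.smooth ⊤).comp (contDiff_id.sub contDiff_const) : ContDiff ℝ _ (fun t => g (t - x))) t
    (n := j) (by exact_mod_cast le_top)
  calc (1 + ‖x‖) ^ k * ((1 + ‖t‖) ^ l * ‖iteratedFDeriv ℝ j (windowS f g x) t‖)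
      ≤ ((1 + ‖t‖) * (1 + ‖t - x‖)) ^ k * ((1 + ‖t‖) ^ l *
        ∑ i ∈ Finset.range (j + 1), (j.choose i : ℝ) * ‖iteratedFDeriv ℝ i f t‖ *
          ‖iteratedFDeriv ℝ (j - i) (fun t => g (t - x)) t‖) := by
        gcongr
        · exact one_add_norm_le_mul_sub x t
        · exact hb
    _ = ∑ i ∈ Finset.range (j + 1), (j.choose i : ℝ) *
          (((1 + ‖t‖) ^ (k + l) * ‖iteratedFDeriv ℝ i f t‖) *
          ((1 + ‖t - x‖) ^ k * ‖iteratedFDeriv ℝ (j - i) g (t - x)‖)) := by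
        rw [Finset.mul_sum, Finset.mul_sum]
        refine Finset.sum_congr rfl fun i _ => ?_
        rw [iteratedFDeriv_comp_sub, mul_pow]
        ring
    _ ≤ ∑ i ∈ Finset.range (j + 1), (j.choose i : ℝ) * (C₁ * C₂) := by
        refine Finset.sum_le_sum fun i hi => ?_
        have hi' : i ≤ j := Nat.lt_succ_iff.1 (Finset.mem_range.1 hi)
        gcongr
        · exact h₁ i (hi'.trans hj) t
        · exact h₂ (j - i) ((Nat.sub_le _ _).trans hj) (t - x)
    _ = 2 ^ j * (C₁ * C₂) := by
        rw [← Finset.sum_mul]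
        congr 1
        exact_mod_cast Nat.sum_range_choose j
    _ ≤ _ := by gcongr; norm_num

theorem exists_integral_norm_iteratedFDeriv_windowS_le (f g : 𝓢(Config n, ℂ)) (k m : ℕ) :
    ∃ C : ℝ, 0 ≤ C ∧ ∀ j ≤ m, ∀ x,
      (1 + ‖x‖) ^ k * ∫ t, ‖iteratedFDeriv ℝ j (windowS f g x) t‖ ≤ C := by
  set l := (volume : Measure (Config n)).integrablePower with hl
  obtain ⟨C, hC, h⟩ := exists_norm_iteratedFDeriv_windowS_le f g k l m
  have hint : Integrable (fun t : Config n => (1 + ‖t‖) ^ (-(l : ℝ))) :=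
    MeasureTheory.Measure.integrable_pow_neg_integrablePower _
  refine ⟨C * ∫ t : Config n, (1 + ‖t‖) ^ (-(l : ℝ)), mul_nonneg hC (integral_nonneg fun t =>
    by positivity), fun j hj x => ?_⟩
  rw [← integral_const_mul, ← integral_const_mul]
  refine integral_mono ?_ (hint.const_mul _) fun t => ?_
  · refine Integrable.const_mul ?_ _
    simpa using (windowS f g x).integrable_pow_mul_iteratedFDeriv volume 0 j
  · have h1 := h j hj x t
    have hp : 0 < (1 + ‖t‖) ^ l := by positivity
    simp only
    rw [Real.rpow_neg (by positivity), Real.rpow_natCast, ← div_eq_mul_inv, le_div_iff₀ hp]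
    linarith

/-- The cross-ambiguity function `(x, y) ↦ ∫ f(t) g(t - x) exp(-2πi y⬝t) dt`. -/
def ambiguity (f g : 𝓢(Config n, ℂ)) (x y : Config n) : ℂ :=
  FourierTransform.fourier (windowS f g x : Config n → ℂ) y

theorem ambiguity_eq (f g : 𝓢(Config n, ℂ)) (x y : Config n) :
    ambiguity f g x y =
      ∫ t, Complex.exp (((-2 * Real.pi * ⟪t, y⟫ : ℝ) : ℂ) * Complex.I) * (f t * g (t - x)) := by
  rw [ambiguity, Real.fourier_eq']
  simp only [windowS_apply, smul_eq_mul]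

/-- Powers of y are paid for by t-derivatives of the window, whose L¹ norms already decay in x. -/
theorem exists_pow_mul_norm_ambiguity_le (f g : 𝓢(Config n, ℂ)) (k m : ℕ) :
    ∃ C : ℝ, 0 ≤ C ∧ ∀ x y, (1 + ‖x‖) ^ k * (‖y‖ ^ m * ‖ambiguity f g x y‖) ≤ C := by
  obtain ⟨C, hC, h⟩ := exists_integral_norm_iteratedFDeriv_windowS_le f g k m
  refine ⟨2 ^ m * ((m + 1) * C), by positivity, fun x y => ?_⟩
  have h1 := Real.pow_mul_norm_iteratedFDeriv_fourier_le (K := ⊤) (N := ⊤)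
    ((windowS f g x).smooth ⊤)
    (fun k n _ _ => (windowS f g x).integrable_pow_mul_iteratedFDeriv volume k n)
    (k := 0) (n := m) le_top le_top y
  simp only [norm_iteratedFDeriv_zero, pow_zero, one_mul, Nat.cast_zero, mul_zero, zero_add,
    Finset.range_one, Finset.singleton_product, Finset.sum_map, Function.Embedding.coeFn_mk] at h1
  calc (1 + ‖x‖) ^ k * (‖y‖ ^ m * ‖ambiguity f g x y‖)
      ≤ (1 + ‖x‖) ^ k * (2 ^ m * ∑ j ∈ Finset.range (m + 1),
        ∫ t, ‖iteratedFDeriv ℝ j (windowS f g x) t‖) := by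
        exact mul_le_mul_of_nonneg_left h1 (by positivity)
    _ = 2 ^ m * ∑ j ∈ Finset.range (m + 1),
        (1 + ‖x‖) ^ k * ∫ t, ‖iteratedFDeriv ℝ j (windowS f g x) t‖ := by
        rw [Finset.mul_sum, Finset.mul_sum, Finset.mul_sum]
        exact Finset.sum_congr rfl fun j _ => by ring
    _ ≤ 2 ^ m * ∑ j ∈ Finset.range (m + 1), C := by
        gcongr with j hj
        exact h j (Nat.lt_succ_iff.1 (Finset.mem_range.1 hj)) x
    _ = _ := by simp

/-- The cross-ambiguity function of Schwartz functions is rapidly decreasing. -/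
theorem exists_norm_ambiguity_le (f g : 𝓢(Config n, ℂ)) (k : ℕ) :
    ∃ C : ℝ, 0 ≤ C ∧ ∀ x y, (1 + ‖x‖) ^ k * (1 + ‖y‖) ^ k * ‖ambiguity f g x y‖ ≤ C := by
  obtain ⟨C₀, hC₀, h₀⟩ := exists_pow_mul_norm_ambiguity_le f g k 0
  obtain ⟨C₁, hC₁, h₁⟩ := exists_pow_mul_norm_ambiguity_le f g k k
  refine ⟨2 ^ (k - 1) * (C₀ + C₁), by positivity, fun x y => ?_⟩
  have h2 : (1 + ‖y‖) ^ k ≤ 2 ^ (k - 1) * (1 + ‖y‖ ^ k) := by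
    simpa using add_pow_le (zero_le_one (α := ℝ)) (norm_nonneg y) k
  calc (1 + ‖x‖) ^ k * (1 + ‖y‖) ^ k * ‖ambiguity f g x y‖
      ≤ (1 + ‖x‖) ^ k * (2 ^ (k - 1) * (1 + ‖y‖ ^ k)) * ‖ambiguity f g x y‖ := by gcongr
    _ = 2 ^ (k - 1) * ((1 + ‖x‖) ^ k * (‖y‖ ^ 0 * ‖ambiguity f g x y‖) +
          (1 + ‖x‖) ^ k * (‖y‖ ^ k * ‖ambiguity f g x y‖)) := by ring
    _ ≤ _ := by gcongr; exacts [h₀ x y, h₁ x y]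

theorem continuous_ambiguity (f g : 𝓢(Config n, ℂ)) :
    Continuous fun z : Phase n => ambiguity f g z.1 z.2 := by
  simp only [ambiguity_eq]
  obtain ⟨C, hC, h⟩ := g.exists_one_add_pow_mul_norm_iteratedFDeriv_le 0 0
  refine continuous_of_dominated (bound := fun t => ‖f t‖ * C) (fun z => ?_) (fun z => ?_)
    (f.integrable.norm.mul_const C) ?_
  · exact Continuous.aestronglyMeasurable (by
      have := f.continuous
      have := g.continuous
      fun_prop)
  · refine Eventually.of_forall fun t => ?_
    rw [norm_mul, Complex.norm_exp_ofReal_mul_I, one_mul, norm_mul]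
    gcongr
    simpa using h 0 le_rfl (t - z.1)
  · refine Eventually.of_forall fun t => ?_
    have := g.continuous
    fun_prop

/-! ### Rapidly decreasing functions on the phase space -/

instance Phase.instIsAddHaarMeasure : (volume : Measure (Phase n)).IsAddHaarMeasure :=
  inferInstanceAs ((volume : Measure (Config n)).prod volume).IsAddHaarMeasure

theorem integrable_pow_neg_prod (n : ℕ) :
    ∃ l : ℕ, ∀ k ≥ l, Integrable (fun z : Phase n => ((1 + ‖z‖) ^ k)⁻¹) := by
  refine ⟨Module.finrank ℝ (Phase n) + 1, fun k hk => ?_⟩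
  have := integrable_one_add_norm (E := Phase n) (μ := volume) (r := k)
    (by exact_mod_cast Nat.lt_of_succ_le hk)
  simpa only [Real.rpow_neg (add_nonneg zero_le_one (norm_nonneg _)), Real.rpow_natCast] using this

/-- A function on the phase space is rapidly decreasing. -/
def RapidDecay (F : Phase n → ℂ) : Prop :=
  Continuous F ∧ ∀ k : ℕ, ∃ C : ℝ, 0 ≤ C ∧ ∀ z, ‖F z‖ ≤ C * ((1 + ‖z‖) ^ k)⁻¹

theorem RapidDecay.integrable {F : Phase n → ℂ} (hF : RapidDecay F) : Integrable F := by
  obtain ⟨l, hl⟩ := integrable_pow_neg_prod n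
  obtain ⟨C, _, h⟩ := hF.2 l
  exact ((hl l le_rfl).const_mul C).mono' hF.1.aestronglyMeasurable (Eventually.of_forall h)

theorem RapidDecay.conj {F : Phase n → ℂ} (hF : RapidDecay F) :
    RapidDecay fun z => conj (F z) :=
  ⟨Complex.continuous_conj.comp hF.1, fun k => by simpa using hF.2 k⟩

theorem RapidDecay.bdd_mul {F G : Phase n → ℂ} (hF : RapidDecay F) (hG : Continuous G) {K : ℝ}
    (hK : ∀ z, ‖G z‖ ≤ K) : RapidDecay fun z => G z * F z := by
  have hK0 : 0 ≤ K := (norm_nonneg _).trans (hK 0)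
  refine ⟨hG.mul hF.1, fun k => ?_⟩
  obtain ⟨C, hC, h⟩ := hF.2 k
  refine ⟨K * C, by positivity, fun z => ?_⟩
  rw [norm_mul, mul_assoc]
  exact mul_le_mul (hK z) (h z) (norm_nonneg _) hK0

theorem RapidDecay.mul {F G : Phase n → ℂ} (hF : RapidDecay F) (hG : RapidDecay G) :
    RapidDecay fun z => G z * F z := by
  obtain ⟨C, _, h⟩ := hG.2 0
  exact hF.bdd_mul hG.1 (K := C) fun z => by simpa using h z

theorem rapidDecay_ambiguity (f g : 𝓢(Config n, ℂ)) :
    RapidDecay fun z => ambiguity f g z.1 z.2 := by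
  refine ⟨continuous_ambiguity f g, fun k => ?_⟩
  obtain ⟨C, hC, h⟩ := exists_norm_ambiguity_le f g k
  refine ⟨C, hC, fun z => ?_⟩
  rw [← div_eq_mul_inv, le_div_iff₀' (by positivity)]
  refine le_trans ?_ (h z.1 z.2)
  rw [← mul_pow]
  gcongr
  rw [Prod.norm_def]
  rcases max_cases ‖z.1‖ ‖z.2‖ with h | h <;> rw [h.1] <;>
    nlinarith [norm_nonneg z.1, norm_nonneg z.2, mul_nonneg (norm_nonneg z.1) (norm_nonneg z.2)]

theorem RapidDecay.comp_smul_snd {F : Phase n → ℂ} (hF : RapidDecay F) {c : ℝ} (hc : c ≠ 0) :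
    RapidDecay fun z : Phase n => F (z.1, c • z.2) := by
  refine ⟨hF.1.comp (by fun_prop), fun k => ?_⟩
  obtain ⟨C, hC, h⟩ := hF.2 k
  refine ⟨C * (1 + |c|⁻¹) ^ k, by positivity, fun z => (h _).trans ?_⟩
  rw [mul_assoc, ← inv_inv ((1 + |c|⁻¹) ^ k), ← mul_inv]
  gcongr
  rw [inv_mul_eq_div, div_le_iff₀' (by positivity), ← mul_pow]
  gcongr
  have hc' : 0 < |c| := abs_pos.2 hc
  have h1 : ‖z‖ ≤ (1 + |c|⁻¹) * ‖(z.1, c • z.2)‖ := by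
    have h2 := norm_fst_le (z.1, c • z.2)
    have h3 := norm_snd_le (z.1, c • z.2)
    simp only [norm_smul, Real.norm_eq_abs] at h2 h3
    have h4 : ‖z.2‖ ≤ |c|⁻¹ * ‖(z.1, c • z.2)‖ := by
      rw [inv_mul_eq_div, le_div_iff₀' hc']
      exact h3
    have h5 := norm_nonneg (z.1, c • z.2)
    have h6 : 0 ≤ |c|⁻¹ * ‖(z.1, c • z.2)‖ := by positivity
    rw [Prod.norm_def (x := z), add_mul, one_mul]
    exact max_le (by linarith) (by linarith)
  have : 0 < |c|⁻¹ := by positivity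
  nlinarith

/-! ### Moyal's identity and reduction to the ambiguity function -/

/-- As a function of x, the inner integral is the convolution of f₁ conj(f₂) with the reflection of
g₁ conj(g₂), and the integral of a convolution is the product of the integrals. -/
theorem integral_window_mul_conj (f₁ g₁ f₂ g₂ : 𝓢(Config n, ℂ)) :
    ∫ x, ∫ t, windowS f₁ g₁ x t * conj (windowS f₂ g₂ x t) =
      (∫ t, f₁ t * conj (f₂ t)) * ∫ t, g₁ t * conj (g₂ t) := by
  have hmul : ∀ f g : 𝓢(Config n, ℂ), Integrable fun t => f t * conj (g t) := fun f g =>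
    (SchwartzMap.pairing (ContinuousLinearMap.mul ℂ ℂ) f (conjS g)).integrable
  have h := integral_convolution (ContinuousLinearMap.mul ℝ ℂ) (μ := volume) (ν := volume)
    (hmul f₁ f₂) (hmul (reflectS g₁) (reflectS g₂))
  simp only [convolution_def, ContinuousLinearMap.mul_apply', reflectS_apply, neg_sub] at h
  rw [integral_neg_eq_self (fun t => g₁ t * conj (g₂ t))] at h
  rw [← h]
  refine integral_congr_ae (Eventually.of_forall fun x => integral_congr_ae
    (Eventually.of_forall fun t => ?_))
  simp only [windowS_apply, map_mul]
  ring

/-- Moyal's identity. -/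
theorem integral_ambiguity_mul_conj (f₁ g₁ f₂ g₂ : 𝓢(Config n, ℂ)) {c : ℝ} (hc : c ≠ 0) :
    ∫ z : Phase n, ambiguity f₁ g₁ z.1 (c • z.2) * conj (ambiguity f₂ g₂ z.1 (c • z.2)) =
      ((|(c ^ n)⁻¹| : ℝ) : ℂ) *
        ((∫ t, f₁ t * conj (f₂ t)) * ∫ t, g₁ t * conj (g₂ t)) := by
  have hint : Integrable (fun z : Phase n =>
      ambiguity f₁ g₁ z.1 (c • z.2) * conj (ambiguity f₂ g₂ z.1 (c • z.2)))
      ((volume : Measure (Config n)).prod volume) :=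
    (((rapidDecay_ambiguity f₂ g₂).comp_smul_snd hc).conj.mul
      ((rapidDecay_ambiguity f₁ g₁).comp_smul_snd hc)).integrable
  -- For each fixed x, rescaling y yields the factor |c|⁻ⁿ and Plancherel in y returns to the
  -- windows.
  rw [Measure.volume_eq_prod, integral_prod _ hint, ← integral_window_mul_conj,
    ← integral_const_mul]
  refine integral_congr_ae (Eventually.of_forall fun x => ?_)
  simp only
  rw [Measure.integral_comp_smul volume
    (fun y => ambiguity f₁ g₁ x y * conj (ambiguity f₂ g₂ x y)), finrank_euclideanSpace_fin,
    Complex.real_smul]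
  congr 1
  have h := SchwartzMap.integral_inner_fourier_fourier (windowS f₂ g₂ x) (windowS f₁ g₁ x)
  simpa only [RCLike.inner_apply] using! h

theorem fourierWigner_eq_ambiguity (hbar : ℝ) (f φ : 𝓢(Config n, ℂ)) (z : Phase n) :
    fourierWigner hbar f φ z =
      Complex.exp (-(Real.pi * Complex.I * hbar * (⟪z.1, z.2⟫ : ℝ))) *
        ambiguity f (conjS φ) z.1 ((-hbar) • z.2) := by
  rw [fourierWigner, ambiguity_eq, ← integral_const_mul]
  refine integral_congr_ae (Eventually.of_forall fun t => ?_)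
  simp only [schrodinger, conjS_apply, map_mul, ← Complex.exp_conj, Complex.conj_I,
    Complex.conj_ofReal, inner_smul_right, real_inner_comm z.2 t]
  rw [← mul_assoc (Complex.exp _) (Complex.exp _), ← Complex.exp_add, mul_left_comm]
  congr 2
  push_cast
  ring

theorem schrodingerCoeff_eq_ambiguity (hbar : ℝ) (f g : 𝓢(Config n, ℂ)) (z : Phase n) :
    schrodingerCoeff hbar f g z =
      Complex.exp (Real.pi * Complex.I * hbar * (⟪z.1, z.2⟫ : ℝ)) *
        ambiguity (conjS g) f z.1 (hbar • z.2) := by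
  rw [schrodingerCoeff, ambiguity_eq, ← integral_const_mul]
  refine integral_congr_ae (Eventually.of_forall fun t => ?_)
  simp only [schrodinger, conjS_apply, inner_smul_right, real_inner_comm z.2 t]
  rw [← mul_assoc (Complex.exp _) (Complex.exp _), ← Complex.exp_add, mul_assoc,
    mul_comm (f _)]
  congr 2
  push_cast
  ring

theorem norm_cexp_pi_mul_I (hbar r : ℝ) :
    ‖Complex.exp (Real.pi * Complex.I * hbar * (r : ℝ))‖ = 1 := by
  rw [← Complex.norm_exp_ofReal_mul_I (Real.pi * hbar * r)]
  congr 2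
  push_cast
  ring

theorem rapidDecay_fourierWigner {hbar : ℝ} (hh : hbar ≠ 0) (f φ : 𝓢(Config n, ℂ)) :
    RapidDecay (fourierWigner hbar f φ) := by
  rw [funext (fourierWigner_eq_ambiguity hbar f φ)]
  refine ((rapidDecay_ambiguity f (conjS φ)).comp_smul_snd (neg_ne_zero.2 hh)).bdd_mul
    (by fun_prop) (K := 1) fun z => ?_
  rw [Complex.exp_neg, norm_inv, norm_cexp_pi_mul_I, inv_one]

theorem rapidDecay_schrodingerCoeff {hbar : ℝ} (hh : hbar ≠ 0) (f g : 𝓢(Config n, ℂ)) :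
    RapidDecay (schrodingerCoeff hbar f g) := by
  rw [funext (schrodingerCoeff_eq_ambiguity hbar f g)]
  exact ((rapidDecay_ambiguity (conjS g) f).comp_smul_snd hh).bdd_mul
    (by fun_prop) (K := 1) fun z => (norm_cexp_pi_mul_I _ _).le

/-! ### The Wigner transform and its covariance -/

/-- Fourier inversion for the cross-ambiguity function in its second variable. -/
theorem integral_cexp_mul_ambiguity (f g : 𝓢(Config n, ℂ)) (x t : Config n) :
    ∫ y, Complex.exp (((2 * Real.pi * ⟪y, t⟫ : ℝ) : ℂ) * Complex.I) * ambiguity f g x y =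
      f t * g (t - x) := by
  have h := congrArg (fun h : 𝓢(Config n, ℂ) => h t)
    (FourierTransform.fourierInv_fourier_eq (F := 𝓢(Config n, ℂ)) (windowS f g x))
  simp only [SchwartzMap.fourierInv_coe, SchwartzMap.fourier_coe, Real.fourierInv_eq', windowS_apply,
    smul_eq_mul] at h
  exact h

theorem integral_comp_two_smul_sub (G : Config n → ℂ) (x : Config n) :
    ∫ t, G ((2 : ℝ) • t - x) = (((2 : ℝ) ^ n)⁻¹ : ℝ) * ∫ t, G t := by
  rw [Measure.integral_comp_smul volume (fun s => G (s - x)), finrank_euclideanSpace_fin,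
    integral_sub_right_eq_self, Complex.real_smul, abs_of_nonneg (by positivity)]

/-- The symplectic Fourier transform of a matrix coefficient is a Wigner transform. -/
theorem symplecticFourier_schrodingerCoeff {hbar : ℝ} (hh : 0 < hbar) (f g : 𝓢(Config n, ℂ))
    (z : Phase n) :
    symplecticFourier hbar (schrodingerCoeff hbar f g) (-z) =
      ∫ t, Complex.exp (Real.pi * Complex.I * hbar * ((⟪z.1, z.2⟫ - 2 * ⟪t, z.2⟫ : ℝ) : ℂ)) *
        (conj (g t) * f (z.1 - t)) := by
  have hint : Integrable (fun w : Phase n => schrodingerCoeff hbar f g w * Complex.exp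
      (Real.pi * Complex.I * hbar * ((⟪w.1, (-z).2⟫ - ⟪w.2, (-z).1⟫ : ℝ) : ℂ)))
      ((volume : Measure (Config n)).prod volume) := by
    simp_rw [mul_comm (schrodingerCoeff hbar f g _)]
    exact ((rapidDecay_schrodingerCoeff hh.ne' f g).bdd_mul (by fun_prop) (K := 1)
      fun w => (norm_cexp_pi_mul_I _ _).le).integrable
  -- All phases in y combine to exp(2πi ħy⬝(x + z.1)/2), so Fourier inversion evaluates the window
  -- at (x + z.1)/2.
  have hinner : ∀ x : Config n, ∫ y : Config n, schrodingerCoeff hbar f g (x, y) * Complex.exp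
      (Real.pi * Complex.I * hbar * ((⟪x, (-z).2⟫ - ⟪y, (-z).1⟫ : ℝ) : ℂ)) =
      (((hbar ^ n)⁻¹ : ℝ) : ℂ) * (Complex.exp (Real.pi * Complex.I * hbar * (-⟪x, z.2⟫ : ℝ)) *
        (conj (g ((2⁻¹ : ℝ) • (x + z.1))) * f ((2⁻¹ : ℝ) • (z.1 - x)))) := by
    intro x
    have h1 := integral_cexp_mul_ambiguity (conjS g) f x ((2⁻¹ : ℝ) • (x + z.1))
    have h2 := Measure.integral_comp_smul volume (fun y : Config n =>
      Complex.exp (((2 * Real.pi * ⟪y, (2⁻¹ : ℝ) • (x + z.1)⟫ : ℝ) : ℂ) * Complex.I) *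
        ambiguity (conjS g) f x y) hbar
    rw [h1, finrank_euclideanSpace_fin, Complex.real_smul, abs_of_nonneg (by positivity),
      conjS_apply, show (2⁻¹ : ℝ) • (x + z.1) - x = (2⁻¹ : ℝ) • (z.1 - x) by module] at h2
    rw [mul_left_comm, ← h2, ← integral_const_mul]
    refine integral_congr_ae (Eventually.of_forall fun y => ?_)
    simp only
    rw [schrodingerCoeff_eq_ambiguity, mul_right_comm, ← mul_assoc, ← Complex.exp_add,
      ← Complex.exp_add]
    congr 2
    simp only [Prod.fst_neg, Prod.snd_neg, inner_neg_right, inner_smul_left, inner_smul_right,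
      inner_add_right, real_inner_comm y x, conj_trivial]
    push_cast
    ring
  rw [symplecticFourier, Measure.volume_eq_prod, integral_prod _ hint]
  simp only [hinner]
  -- The remaining constant 2⁻ⁿ is the Jacobian of the substitution x = 2t - z.1.
  rw [integral_const_mul, ← mul_assoc, ← Complex.ofReal_mul,
    show (hbar / 2) ^ n * (hbar ^ n)⁻¹ = (2 ^ n)⁻¹ by
      rw [div_pow]
      field_simp,
    ← integral_comp_two_smul_sub _ z.1]
  refine integral_congr_ae (Eventually.of_forall fun t => ?_)
  simp only
  rw [show (2⁻¹ : ℝ) • ((2 : ℝ) • t - z.1 + z.1) = t by module,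
    show (2⁻¹ : ℝ) • (z.1 - ((2 : ℝ) • t - z.1)) = z.1 - t by module,
    inner_sub_left, inner_smul_left, conj_trivial]
  congr 3
  push_cast
  ring

/-- Since f(z.1 - t) is the reflection of f at t - z.1, a Wigner transform is an ambiguity function.
Decay and Moyal's identity thus become available for û. -/
theorem symplecticFourier_schrodingerCoeff_eq_ambiguity {hbar : ℝ} (hh : 0 < hbar)
    (f g : 𝓢(Config n, ℂ)) (z : Phase n) :
    symplecticFourier hbar (schrodingerCoeff hbar f g) (-z) =
      Complex.exp (Real.pi * Complex.I * hbar * (⟪z.1, z.2⟫ : ℝ)) *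
        ambiguity (conjS g) (reflectS f) z.1 (hbar • z.2) := by
  rw [symplecticFourier_schrodingerCoeff hh, ambiguity_eq, ← integral_const_mul]
  refine integral_congr_ae (Eventually.of_forall fun t => ?_)
  simp only [conjS_apply, reflectS_apply, neg_sub, inner_smul_right]
  rw [← mul_assoc (Complex.exp _) (Complex.exp _), ← Complex.exp_add]
  congr 2
  push_cast
  ring

theorem rapidDecay_symplecticFourier_schrodingerCoeff {hbar : ℝ} (hh : 0 < hbar)
    (f g : 𝓢(Config n, ℂ)) :
    RapidDecay fun z => symplecticFourier hbar (schrodingerCoeff hbar f g) (-z) := by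
  rw [funext (symplecticFourier_schrodingerCoeff_eq_ambiguity hh f g)]
  exact ((rapidDecay_ambiguity (conjS g) (reflectS f)).comp_smul_snd hh.ne').bdd_mul
    (by fun_prop) (K := 1) fun z => (norm_cexp_pi_mul_I _ _).le

/-- Covariance of the Wigner transform under the Schrödinger representation. -/
theorem symplecticFourier_schrodingerCoeff_add {hbar : ℝ} (hh : 0 < hbar)
    (f g : 𝓢(Config n, ℂ)) (z w : Phase n) :
    symplecticFourier hbar (schrodingerCoeff hbar f g) (-(z + (2 : ℝ) • w)) =
      symplecticFourier hbar (schrodingerCoeff hbar (schrodingerS hbar (-w) f)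
        (schrodingerS hbar (-w) g)) (-z) := by
  -- Shifting t by w.1 translates the arguments t and z.1 - t by w.1 each, which accounts for 2w on
  -- the left.
  rw [symplecticFourier_schrodingerCoeff hh, symplecticFourier_schrodingerCoeff hh,
    ← integral_add_right_eq_self _ w.1]
  refine integral_congr_ae (Eventually.of_forall fun t => ?_)
  simp only [coe_schrodingerS, schrodinger, map_mul, ← Complex.exp_conj, Complex.conj_I,
    Complex.conj_ofReal, Prod.fst_neg, Prod.snd_neg, sub_neg_eq_add, Prod.fst_add, Prod.snd_add,
    Prod.smul_fst, Prod.smul_snd]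
  rw [show z.1 + (2 : ℝ) • w.1 - (t + w.1) = z.1 - t + w.1 by module]
  rw [mul_mul_mul_comm (Complex.exp _) _ (Complex.exp _), ← Complex.exp_add,
    ← mul_assoc (Complex.exp _) (Complex.exp _), ← Complex.exp_add]
  congr 2
  simp only [inner_add_left, inner_add_right, inner_sub_right, inner_smul_left, inner_smul_right,
    inner_neg_left, inner_neg_right, conj_trivial, real_inner_comm w.2 t, real_inner_comm w.2 z.1]
  push_cast
  ring

theorem conj_ambiguity (f g : 𝓢(Config n, ℂ)) (x y : Config n) :
    conj (ambiguity f g x y) = ambiguity (conjS f) (conjS g) x (-y) := by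
  rw [ambiguity_eq, ambiguity_eq, ← integral_conj]
  refine integral_congr_ae (Eventually.of_forall fun t => ?_)
  simp [← Complex.exp_conj, Complex.conj_ofNat]

@[simp] theorem conjS_conjS (f : 𝓢(Config n, ℂ)) : conjS (conjS f) = f := by
  ext t
  simp

/-! ### Weyl form and closed form of the mixed Gaussian -/

/-- The phases of the two factors are opposite and cancel, leaving Moyal's identity with scaling -ħ.
The reflection in the Wigner transform ends up on φ₂. -/
theorem integral_fourierWigner_mul_symplecticFourier {hbar : ℝ} (hh : 0 < hbar)
    (φ₁ φ₂ f g : 𝓢(Config n, ℂ)) :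
    ∫ z, fourierWigner hbar φ₁ φ₂ z *
        symplecticFourier hbar (schrodingerCoeff hbar f g) (-z) =
      (((hbar ^ n)⁻¹ : ℝ) : ℂ) *
        ((∫ t, φ₁ t * conj (g t)) * ∫ t, f t * conj (φ₂ (-t))) := by
  have h := integral_ambiguity_mul_conj φ₁ (conjS φ₂) g (conjS (reflectS f))
    (neg_ne_zero.2 hh.ne')
  rw [abs_inv, abs_pow, abs_neg, abs_of_pos hh] at h
  have h2 : ∫ t, f t * conj (φ₂ (-t)) =
      ∫ t, conjS φ₂ t * conj (conjS (reflectS f) t) := by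
    rw [← integral_neg_eq_self]
    refine integral_congr_ae (Eventually.of_forall fun t => ?_)
    simp [mul_comm]
  rw [h2, ← h]
  refine integral_congr_ae (Eventually.of_forall fun z => ?_)
  simp only
  rw [fourierWigner_eq_ambiguity, symplecticFourier_schrodingerCoeff_eq_ambiguity hh,
    conj_ambiguity, conjS_conjS, neg_smul, neg_neg, mul_mul_mul_comm, ← Complex.exp_add,
    neg_add_cancel, Complex.exp_zero, one_mul]

/-- The adjoint of ρ(0,w) is ρ(0,-w). -/
theorem fourierWigner_eq_integral_schrodingerS_neg (hbar : ℝ) (f φ : 𝓢(Config n, ℂ))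
    (w : Phase n) :
    fourierWigner hbar f φ w = ∫ t, schrodingerS hbar (-w) f t * conj (φ t) := by
  rw [fourierWigner, ← integral_add_right_eq_self _ w.1]
  refine integral_congr_ae (Eventually.of_forall fun t => ?_)
  simp only [coe_schrodingerS, schrodinger, map_mul, ← Complex.exp_conj, Complex.conj_I,
    Complex.conj_ofReal, Prod.fst_neg, Prod.snd_neg, sub_neg_eq_add, add_sub_cancel_right]
  rw [← mul_assoc, mul_comm (f _)]
  congr 3
  simp only [inner_add_right, inner_neg_left, inner_neg_right, real_inner_comm w.2 w.1]
  push_cast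
  ring

theorem vacuumS_neg {hbar τ : ℝ} (hh : 0 < hbar) (hτ : 0 < τ) (t : Config n) :
    vacuumS n hh hτ (-t) = vacuumS n hh hτ t := by
  rw [coe_vacuumS]
  simp [vacuum]

theorem mixedGaussian_eq {hbar τ ς : ℝ} (hh : 0 < hbar) (hτ : 0 < τ) (hς : 0 < ς) :
    mixedGaussian (n := n) hbar τ ς = fourierWigner hbar (vacuumS n hh hς) (vacuumS n hh hτ) := by
  funext z
  rw [mixedGaussian, coe_vacuumS, coe_vacuumS]

/-- Covariance moves the translation by 2w onto f and g. Moyal's identity then factors the integral,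
and evenness of the vacuum removes the reflection. -/
theorem integral_mixedGaussian_mul_symplecticFourier {hbar τ ς : ℝ} (hh : 0 < hbar) (hτ : 0 < τ)
    (hς : 0 < ς) (f g : 𝓢(Config n, ℂ)) (w : Phase n) :
    ∫ z, mixedGaussian hbar τ ς (z - (2 : ℝ) • w) *
        symplecticFourier hbar (schrodingerCoeff hbar f g) (-z) =
      (((hbar ^ n)⁻¹ : ℝ) : ℂ) * (fourierWigner hbar f (vacuum hbar τ) w *
        conj (fourierWigner hbar g (vacuum hbar ς) w)) := by
  rw [← coe_vacuumS hh hτ, ← coe_vacuumS hh hς, ← integral_add_right_eq_self _ ((2 : ℝ) • w)]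
  simp only [add_sub_cancel_right, symplecticFourier_schrodingerCoeff_add hh]
  rw [mixedGaussian_eq hh hτ hς, integral_fourierWigner_mul_symplecticFourier hh,
    fourierWigner_eq_integral_schrodingerS_neg, fourierWigner_eq_integral_schrodingerS_neg,
    ← integral_conj, mul_comm (∫ t, vacuumS n hh hς t * _)]
  simp only [vacuumS_neg, map_mul, Complex.conj_conj]
  simp only [mul_comm (vacuumS n hh hς _)]

theorem mixedGaussian_closed_form {hbar τ ς : ℝ} (hh : 0 < hbar) (hτ : 0 < τ) (hς : 0 < ς)
    (x y : Config n) : mixedGaussian hbar τ ς (x, y) =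
      (((4 * τ * ς / (τ + ς) ^ 2) ^ ((n : ℝ) / 4) : ℝ) : ℂ) *
        Complex.exp (-(Real.pi * hbar / (τ + ς)) *
          (Complex.I * ((τ - ς : ℝ) : ℂ) * ((inner ℝ x y : ℝ) : ℂ) +
            ((‖x‖ ^ 2 + τ * ς * ‖y‖ ^ 2 : ℝ) : ℂ))) := by
  have hpi := Real.pi_pos
  have hs : 0 < τ + ς := add_pos hτ hς
  set b : ℝ := Real.pi * hbar * (τ + ς) / (τ * ς) with hb
  have hb0 : 0 < b := by positivity
  have hG := GaussianFourier.integral_cexp_neg_mul_sq_norm_add (V := Config n) (b := (b : ℂ))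
    (by simpa using hb0) (2 * Real.pi * hbar * Complex.I) y
  -- The point (ς/(τ + ς))x minimises |t|²/ς + |t - x|²/τ, so centring there removes the cross term
  -- ⟨v, x⟩.
  have key : ∀ v : Config n, vacuum hbar ς (v + (ς / (τ + ς)) • x) *
      conj (schrodinger hbar 0 x y (vacuum hbar τ) (v + (ς / (τ + ς)) • x)) =
      (((2 * hbar / ς) ^ ((n : ℝ) / 4) * (2 * hbar / τ) ^ ((n : ℝ) / 4) : ℝ) : ℂ) *
      (Complex.exp (-(Real.pi * hbar / (τ + ς)) *
          (Complex.I * ((τ - ς : ℝ) : ℂ) * ((inner ℝ x y : ℝ) : ℂ) + ((‖x‖ ^ 2 : ℝ) : ℂ))) *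
      Complex.exp (-b * ‖v‖ ^ 2 + 2 * Real.pi * hbar * Complex.I * (⟪y, v⟫ : ℝ))) := by
    intro v
    have e1 : ‖v + (ς / (τ + ς)) • x‖ ^ 2 =
        ‖v‖ ^ 2 + 2 * (ς / (τ + ς)) * ⟪v, x⟫ + (ς / (τ + ς)) ^ 2 * ‖x‖ ^ 2 := by
      rw [norm_add_sq_real, inner_smul_right, norm_smul, mul_pow, Real.norm_eq_abs, sq_abs]
      ring
    have e2 : ‖v + (ς / (τ + ς)) • x - x‖ ^ 2 =
        ‖v‖ ^ 2 - 2 * (τ / (τ + ς)) * ⟪v, x⟫ + (τ / (τ + ς)) ^ 2 * ‖x‖ ^ 2 := by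
      rw [show v + (ς / (τ + ς)) • x - x = v + (-(τ / (τ + ς))) • x by
        rw [add_sub_assoc]
        congr 1
        rw [show (ς / (τ + ς)) • x - x = (ς / (τ + ς) - 1) • x by module]
        congr 1
        field_simp
        ring,
        norm_add_sq_real, inner_smul_right, norm_smul, mul_pow, Real.norm_eq_abs, sq_abs]
      ring
    simp only [vacuum, schrodinger, map_mul, ← Complex.exp_conj, Complex.conj_I,
      Complex.conj_ofReal, Complex.ofReal_mul, Complex.ofReal_exp, e1, e2, inner_add_right,
      inner_smul_right, real_inner_comm x y]
    rw [show ∀ a b c d e : ℂ, a * b * (c * (d * e)) = a * d * (c * (b * e)) from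
      fun a b c d e => by ring]
    rw [← Complex.exp_add, ← Complex.exp_add, ← Complex.exp_add, ← Complex.ofReal_mul]
    congr 2
    rw [hb]
    have h1 : (τ : ℂ) ≠ 0 := Complex.ofReal_ne_zero.2 hτ.ne'
    have h2 : (ς : ℂ) ≠ 0 := Complex.ofReal_ne_zero.2 hς.ne'
    have h3 : (τ : ℂ) + ς ≠ 0 := by
      rw [← Complex.ofReal_add]
      exact Complex.ofReal_ne_zero.2 hs.ne'
    push_cast
    field_simp
    ring
  have hconst : (2 * hbar / ς) ^ ((n : ℝ) / 4) * (2 * hbar / τ) ^ ((n : ℝ) / 4) *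
      (Real.pi / b) ^ ((n : ℝ) / 2) = (4 * τ * ς / (τ + ς) ^ 2) ^ ((n : ℝ) / 4) := by
    rw [show (n : ℝ) / 2 = (2 : ℕ) * ((n : ℝ) / 4) by push_cast; ring,
      Real.rpow_mul (by positivity), Real.rpow_natCast, ← Real.mul_rpow (by positivity)
      (by positivity), ← Real.mul_rpow (by positivity) (by positivity), hb]
    congr 1
    field_simp
    ring
  have hcpow : ((Real.pi : ℂ) / b) ^ ((Module.finrank ℝ (Config n) : ℂ) / 2) =
      (((Real.pi / b) ^ ((n : ℝ) / 2) : ℝ) : ℂ) := by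
    rw [finrank_euclideanSpace_fin, Complex.ofReal_cpow (by positivity)]
    push_cast
    rfl
  rw [mixedGaussian, fourierWigner, ← integral_add_right_eq_self _ ((ς / (τ + ς)) • x)]
  simp only [key]
  rw [integral_const_mul, integral_const_mul, hG, hcpow, ← hconst, mul_left_comm (Complex.exp _),
    ← mul_assoc, ← Complex.ofReal_mul, ← Complex.exp_add]
  congr 2
  rw [hb]
  have h1 : (τ : ℂ) ≠ 0 := Complex.ofReal_ne_zero.2 hτ.ne'
  have h2 : (ς : ℂ) ≠ 0 := Complex.ofReal_ne_zero.2 hς.ne'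
  have h3 : (τ : ℂ) + ς ≠ 0 := by
    rw [← Complex.ofReal_add]
    exact Complex.ofReal_ne_zero.2 hs.ne'
  have h4 : (Real.pi : ℂ) ≠ 0 := Complex.ofReal_ne_zero.2 hpi.ne'
  have h5 : (hbar : ℂ) ≠ 0 := Complex.ofReal_ne_zero.2 hh.ne'
  push_cast
  field_simp
  rw [Complex.I_sq]
  ring

/-! ### The pre-FSB transform as a unitary map -/

theorem RapidDecay.memLp_two {F : Phase n → ℂ} (hF : RapidDecay F) : MemLp F 2 volume := by
  rw [memLp_two_iff_integrable_sq_norm hF.1.aestronglyMeasurable]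
  refine (hF.mul hF.conj).integrable.norm.congr (Eventually.of_forall fun z => ?_)
  simp [sq]

theorem fourierWigner_congr {hbar : ℝ} {f g : Config n → ℂ} (h : f =ᵐ[volume] g)
    (φ : Config n → ℂ) : fourierWigner hbar f φ = fourierWigner hbar g φ := by
  funext z
  refine integral_congr_ae ?_
  filter_upwards [h] with t ht
  rw [ht]

/-- At each fixed point z, the transform is thereby a continuous linear functional of f in L². -/
theorem fourierWigner_eq_inner (hbar : ℝ) (f : L2Config n) (φ : 𝓢(Config n, ℂ)) (z : Phase n) :
    fourierWigner hbar f φ z = inner ℂ ((schrodingerS hbar z φ).toLp 2 volume) f := by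
  rw [L2.inner_def, fourierWigner]
  refine integral_congr_ae ?_
  filter_upwards [(schrodingerS hbar z φ).coeFn_toLp 2 volume] with t ht
  rw [ht, RCLike.inner_apply, coe_schrodingerS]

theorem preFSB_eq_inner {hbar τ : ℝ} (hh : 0 < hbar) (hτ : 0 < τ) (f : L2Config n)
    (z : Phase n) :
    preFSB hbar τ f z = ((hbar ^ ((n : ℝ) / 2) : ℝ) : ℂ) *
      inner ℂ ((schrodingerS hbar z (vacuumS n hh hτ)).toLp 2 volume) f := by
  rw [preFSB, ← coe_vacuumS hh hτ, fourierWigner_eq_inner]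

theorem preFSB_congr {hbar τ : ℝ} {f g : Config n → ℂ} (h : f =ᵐ[volume] g) :
    preFSB hbar τ f = preFSB hbar τ g := by
  funext z
  rw [preFSB, preFSB, fourierWigner_congr h]

theorem rapidDecay_preFSB {hbar τ : ℝ} (hh : 0 < hbar) (hτ : 0 < τ) (f : 𝓢(Config n, ℂ)) :
    RapidDecay (preFSB hbar τ f) := by
  have h := (rapidDecay_fourierWigner hh.ne' f (vacuumS n hh hτ)).bdd_mul
    (continuous_const (y := ((hbar ^ ((n : ℝ) / 2) : ℝ) : ℂ))) (fun _ => le_rfl)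
  rwa [coe_vacuumS] at h

/-- This is the closed form of Φ_{ττ} at the origin. -/
theorem integral_vacuumS_mul_conj {hbar τ : ℝ} (hh : 0 < hbar) (hτ : 0 < τ) :
    ∫ t, vacuumS n hh hτ t * conj (vacuumS n hh hτ t) = 1 := by
  have h := mixedGaussian_closed_form (n := n) hh hτ hτ 0 0
  have h1 : 4 * τ * τ / (τ + τ) ^ 2 = 1 := by
    field_simp
    ring
  rw [h1, mixedGaussian, fourierWigner] at h
  simpa [coe_vacuumS, schrodinger] using h

/-- The pre-FSB transform preserves inner products of Schwartz functions. -/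
theorem integral_preFSB_mul_conj {hbar τ : ℝ} (hh : 0 < hbar) (hτ : 0 < τ)
    (f g : 𝓢(Config n, ℂ)) :
    ∫ z, preFSB hbar τ f z * conj (preFSB hbar τ g z) = ∫ t, f t * conj (g t) := by
  have h := integral_ambiguity_mul_conj f (conjS (vacuumS n hh hτ)) g (conjS (vacuumS n hh hτ))
    (neg_ne_zero.2 hh.ne')
  have h1 : ∫ t, conjS (vacuumS n hh hτ) t * conj (conjS (vacuumS n hh hτ) t) = 1 := by
    rw [← integral_vacuumS_mul_conj (n := n) hh hτ]
    refine integral_congr_ae (Eventually.of_forall fun t => ?_)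
    simp [mul_comm]
  rw [h1, mul_one, abs_inv, abs_pow, abs_neg, abs_of_pos hh] at h
  have hpow : (((hbar ^ n)⁻¹ : ℝ) : ℂ) ≠ 0 := Complex.ofReal_ne_zero.2 (by positivity)
  refine mul_left_cancel₀ hpow ?_
  rw [← h, ← integral_const_mul]
  refine integral_congr_ae (Eventually.of_forall fun z => ?_)
  have hsq : (((hbar ^ n)⁻¹ : ℝ) : ℂ) *
      (((hbar ^ ((n : ℝ) / 2) : ℝ) : ℂ) * ((hbar ^ ((n : ℝ) / 2) : ℝ) : ℂ)) = 1 := by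
    rw [← Complex.ofReal_mul, ← Real.rpow_add hh, add_halves, Real.rpow_natCast,
      ← Complex.ofReal_mul, inv_mul_cancel₀ (by positivity), Complex.ofReal_one]
  have hexp : Complex.exp (-(Real.pi * Complex.I * hbar * (⟪z.1, z.2⟫ : ℝ))) *
      conj (Complex.exp (-(Real.pi * Complex.I * hbar * (⟪z.1, z.2⟫ : ℝ)))) = 1 := by
    rw [Complex.mul_conj, Complex.normSq_eq_norm_sq, Complex.exp_neg, norm_inv,
      norm_cexp_pi_mul_I]
    simp
  simp only [preFSB]
  rw [← coe_vacuumS hh hτ, fourierWigner_eq_ambiguity, fourierWigner_eq_ambiguity, map_mul,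
    map_mul, Complex.conj_ofReal, mul_mul_mul_comm, ← mul_assoc, hsq, one_mul, mul_mul_mul_comm,
    hexp, one_mul]

/-- The pre-FSB transform of Schwartz functions, as a linear map into `L²(ℝ²ⁿ)`. -/
def preFSBSchwartz (n : ℕ) {hbar τ : ℝ} (hh : 0 < hbar) (hτ : 0 < τ) :
    𝓢(Config n, ℂ) →ₗ[ℂ] L2Phase n where
  toFun f := (rapidDecay_preFSB hh hτ f).memLp_two.toLp _
  map_add' f g := by
    -- Passing to L² classes turns additivity into that of the inner product, with no separate
    -- integrability to check.
    rw [← MemLp.toLp_add]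
    refine MemLp.toLp_congr _ _ (Eventually.of_forall fun z => ?_)
    rw [Pi.add_apply, ← preFSB_congr (f.coeFn_toLp 2 volume),
      ← preFSB_congr (g.coeFn_toLp 2 volume), ← preFSB_congr ((f + g).coeFn_toLp 2 volume),
      preFSB_eq_inner hh hτ, preFSB_eq_inner hh hτ, preFSB_eq_inner hh hτ, ← mul_add,
      ← inner_add_right]
    rfl
  map_smul' c f := by
    rw [RingHom.id_apply, ← MemLp.toLp_const_smul]
    refine MemLp.toLp_congr _ _ (Eventually.of_forall fun z => ?_)
    rw [Pi.smul_apply, ← preFSB_congr (f.coeFn_toLp 2 volume),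
      ← preFSB_congr ((c • f).coeFn_toLp 2 volume),
      preFSB_eq_inner hh hτ, preFSB_eq_inner hh hτ, smul_eq_mul, mul_left_comm]
    congr 1
    exact inner_smul_right _ (f.toLp 2 volume) c

theorem norm_preFSBSchwartz {hbar τ : ℝ} (hh : 0 < hbar) (hτ : 0 < τ) (f : 𝓢(Config n, ℂ)) :
    ‖preFSBSchwartz n hh hτ f‖ = ‖f.toLp 2 volume‖ := by
  rw [norm_eq_sqrt_re_inner (𝕜 := ℂ), norm_eq_sqrt_re_inner (𝕜 := ℂ)]
  congr 2
  rw [L2.inner_def, L2.inner_def]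
  have h1 := (rapidDecay_preFSB hh hτ f).memLp_two.coeFn_toLp
  have h2 := f.coeFn_toLp 2 volume
  refine Eq.trans (integral_congr_ae ?_) ((integral_preFSB_mul_conj hh hτ f f).trans
    (integral_congr_ae ?_))
  · filter_upwards [h1] with z hz
    rw [RCLike.inner_apply, preFSBSchwartz, LinearMap.coe_mk, AddHom.coe_mk, hz]
  · filter_upwards [h2] with z hz
    rw [RCLike.inner_apply, hz]

/-- The pre-FSB transform on `L²(ℝⁿ)`, by continuous extension from Schwartz functions. -/
def preFSBCLM (n : ℕ) {hbar τ : ℝ} (hh : 0 < hbar) (hτ : 0 < τ) : L2Config n →L[ℂ] L2Phase n :=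
  (preFSBSchwartz n hh hτ).extendOfNorm
    (SchwartzMap.toLpCLM ℂ ℂ 2 (volume : Measure (Config n))).toLinearMap

theorem denseRange_toLp_two :
    DenseRange (fun f : 𝓢(Config n, ℂ) => f.toLp 2 volume) :=
  SchwartzMap.denseRange_toLpCLM (p := 2) (by norm_num)

theorem preFSBCLM_toLp {hbar τ : ℝ} (hh : 0 < hbar) (hτ : 0 < τ) (f : 𝓢(Config n, ℂ)) :
    preFSBCLM n hh hτ (f.toLp 2 volume) = preFSBSchwartz n hh hτ f :=
  LinearMap.extendOfNorm_eq (e := (SchwartzMap.toLpCLM ℂ ℂ 2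
    (volume : Measure (Config n))).toLinearMap) denseRange_toLp_two
    ⟨1, fun f => by rw [one_mul]; exact (norm_preFSBSchwartz hh hτ f).le⟩ f

theorem norm_preFSBCLM {hbar τ : ℝ} (hh : 0 < hbar) (hτ : 0 < τ) (f : L2Config n) :
    ‖preFSBCLM n hh hτ f‖ = ‖f‖ := by
  refine denseRange_toLp_two.induction_on (p := fun f => ‖preFSBCLM n hh hτ f‖ = ‖f‖) f
    (isClosed_eq (by fun_prop) (by fun_prop)) fun φ => ?_
  rw [preFSBCLM_toLp, norm_preFSBSchwartz]

/-- Along Schwartz functions tending to f, the transforms converge in L², hence a.e. along a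
subsequence. They also converge at every point by `preFSB_eq_inner`, so the limits agree a.e. -/
theorem preFSBCLM_ae_eq {hbar τ : ℝ} (hh : 0 < hbar) (hτ : 0 < τ) (f : L2Config n) :
    preFSBCLM n hh hτ f =ᵐ[volume] preFSB hbar τ f := by
  obtain ⟨u, hu⟩ : ∃ u : ℕ → 𝓢(Config n, ℂ),
      Tendsto (fun k => (u k).toLp 2 volume) atTop (𝓝 f) := by
    obtain ⟨x, hx, hlim⟩ := mem_closure_iff_seq_limit.1 (denseRange_toLp_two (n := n) f)
    choose u hu using hx
    exact ⟨u, by simpa only [hu] using hlim⟩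
  have h1 : Tendsto (fun k => preFSBCLM n hh hτ ((u k).toLp 2 volume)) atTop
      (𝓝 (preFSBCLM n hh hτ f)) := ((preFSBCLM n hh hτ).continuous.tendsto f).comp hu
  obtain ⟨ns, hns, hae⟩ := (tendstoInMeasure_of_tendsto_Lp h1).exists_seq_tendsto_ae
  have hcoe : ∀ᵐ z ∂(volume : Measure (Phase n)), ∀ k,
      preFSBCLM n hh hτ ((u k).toLp 2 volume) z =
        preFSB hbar τ ((u k).toLp 2 volume : L2Config n) z := by
    refine ae_all_iff.2 fun k => ?_
    rw [preFSBCLM_toLp, preFSB_congr ((u k).coeFn_toLp 2 volume)]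
    exact (rapidDecay_preFSB hh hτ (u k)).memLp_two.coeFn_toLp
  filter_upwards [hae, hcoe] with z hz hc
  refine tendsto_nhds_unique hz ?_
  simp only [hc, preFSB_eq_inner hh hτ]
  exact ((continuous_const.inner continuous_id).tendsto f |>.comp
    (hu.comp hns.tendsto_atTop)).const_mul _

theorem preFSBCLM_mem {hbar τ : ℝ} (hh : 0 < hbar) (hτ : 0 < τ) (f : L2Config n) :
    preFSBCLM n hh hτ f ∈ fsbSpace n hbar τ :=
  Submodule.le_topologicalClosure _ (Submodule.subset_span ⟨f, preFSBCLM_ae_eq hh hτ f⟩)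

/-- The pre-FSB transform as an isometry into `L²(ℝ²ⁿ)`. -/
def preFSBIsometry (n : ℕ) {hbar τ : ℝ} (hh : 0 < hbar) (hτ : 0 < τ) :
    L2Config n →ₗᵢ[ℂ] L2Phase n :=
  ⟨(preFSBCLM n hh hτ).toLinearMap, norm_preFSBCLM hh hτ⟩

/-- The range of an isometry of a complete space is closed, so neither span nor closure adds
anything. -/
theorem fsbSpace_eq_range {hbar τ : ℝ} (hh : 0 < hbar) (hτ : 0 < τ) :
    fsbSpace n hbar τ = LinearMap.range (preFSBIsometry n hh hτ).toLinearMap := by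
  refine le_antisymm (Submodule.topologicalClosure_minimal _ (Submodule.span_le.2 ?_) ?_) ?_
  · rintro F ⟨f, hF⟩
    exact ⟨f, Lp.ext ((preFSBCLM_ae_eq hh hτ f).trans hF.symm)⟩
  · exact (preFSBIsometry n hh hτ).isometry.isClosedEmbedding.isClosed_range
  · rintro _ ⟨f, rfl⟩
    exact preFSBCLM_mem hh hτ f

/-- The pre-FSB transform as a unitary map onto the pre-FSB space. -/
def preFSBEquiv (n : ℕ) {hbar τ : ℝ} (hh : 0 < hbar) (hτ : 0 < τ) :
    L2Config n ≃ₗᵢ[ℂ] fsbSpace n hbar τ :=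
  LinearIsometryEquiv.ofSurjective
    ⟨(preFSBCLM n hh hτ).toLinearMap.codRestrict _ (preFSBCLM_mem hh hτ), norm_preFSBCLM hh hτ⟩
    (by
      rintro ⟨F, hF⟩
      obtain ⟨f, hf⟩ := (fsbSpace_eq_range hh hτ).le hF
      exact ⟨f, Subtype.ext hf⟩)

theorem coe_preFSBEquiv {hbar τ : ℝ} (hh : 0 < hbar) (hτ : 0 < τ) (f : L2Config n) :
    (preFSBEquiv n hh hτ f : L2Phase n) = preFSBCLM n hh hτ f := rfl

/-! ### Absolute convergence and the Weyl form of the symbol -/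

section PolynomialGrowth

variable {ψ : Phase n → ℂ} {N : ℕ}

theorem aestronglyMeasurable_of_memLp_div_one_add_pow
    (hψ : MemLp (fun z => ψ z / (((1 + ‖z‖) ^ N : ℝ) : ℂ)) 2 volume) :
    AEStronglyMeasurable ψ volume := by
  have hc : Continuous fun z : Phase n => (((1 + ‖z‖) ^ N : ℝ) : ℂ) := by fun_prop
  refine (hψ.aestronglyMeasurable.mul hc.aestronglyMeasurable).congr
    (Eventually.of_forall fun z => div_mul_cancel₀ _ (Complex.ofReal_ne_zero.2 (by positivity)))

theorem RapidDecay.memLp_two_mul (hψ : MemLp (fun z => ψ z / (((1 + ‖z‖) ^ N : ℝ) : ℂ)) 2 volume)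
    {F : Phase n → ℂ} (hF : RapidDecay F) : MemLp (fun z => ψ z * F z) 2 volume := by
  obtain ⟨C, hC, h⟩ := hF.2 N
  refine hψ.of_le_mul (c := C) ((aestronglyMeasurable_of_memLp_div_one_add_pow hψ).mul
    hF.1.aestronglyMeasurable) (Eventually.of_forall fun z => ?_)
  rw [norm_mul, norm_div, Complex.norm_real, Real.norm_of_nonneg (by positivity)]
  calc ‖ψ z‖ * ‖F z‖ ≤ ‖ψ z‖ * (C * ((1 + ‖z‖) ^ N)⁻¹) := by gcongr; exact h z
    _ = _ := by ring

/-- Cauchy–Schwarz: a further weight that is itself in L² converts weighted L² into weighted L¹. -/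
theorem exists_integrable_div_one_add_pow
    (hψ : MemLp (fun z => ψ z / (((1 + ‖z‖) ^ N : ℝ) : ℂ)) 2 volume) :
    ∃ M : ℕ, Integrable fun z => ‖ψ z‖ * ((1 + ‖z‖) ^ M)⁻¹ := by
  obtain ⟨l, hl⟩ := integrable_pow_neg_prod n
  have hc : Continuous fun z : Phase n => ((1 + ‖z‖) ^ l)⁻¹ :=
    Continuous.inv₀ (by fun_prop) fun z => by positivity
  have h2 : MemLp (fun z : Phase n => ((1 + ‖z‖) ^ l)⁻¹) 2 volume := by
    rw [memLp_two_iff_integrable_sq_norm hc.aestronglyMeasurable]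
    refine (hl (l * 2) (by omega)).congr (Eventually.of_forall fun z => ?_)
    simp only
    rw [Real.norm_of_nonneg (by positivity), inv_pow, pow_mul]
  refine ⟨N + l, (hψ.norm.integrable_mul h2).congr (Eventually.of_forall fun z => ?_)⟩
  simp only [Pi.mul_apply]
  rw [norm_div, Complex.norm_real, Real.norm_of_nonneg (by positivity), pow_add, mul_inv,
    div_eq_mul_inv, mul_assoc]

theorem RapidDecay.exists_norm_comp_sub_two_smul_le {F : Phase n → ℂ} (hF : RapidDecay F)
    (M : ℕ) : ∃ C : ℝ, 0 ≤ C ∧ ∀ z w : Phase n,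
      ‖F (z - (2 : ℝ) • w)‖ ≤ C * (1 + ‖z‖) ^ M * ((1 + ‖w‖) ^ M)⁻¹ := by
  obtain ⟨C, hC, h⟩ := hF.2 M
  refine ⟨C, hC, fun z w => (h _).trans ?_⟩
  rw [mul_assoc]
  gcongr
  rw [← div_eq_mul_inv, le_div_iff₀ (by positivity), inv_mul_le_iff₀ (by positivity), ← mul_pow]
  gcongr
  have h1 := one_add_norm_le_mul_sub ((2 : ℝ) • w) z
  rw [norm_smul, Real.norm_of_nonneg zero_le_two] at h1
  linarith [norm_nonneg w]

theorem integrable_mul_comp_sub_two_smul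
    (hψ : MemLp (fun z => ψ z / (((1 + ‖z‖) ^ N : ℝ) : ℂ)) 2 volume)
    {F : Phase n → ℂ} (hF : RapidDecay F) (z : Phase n) :
    Integrable fun w => ψ w * F (z - (2 : ℝ) • w) := by
  obtain ⟨M, hM⟩ := exists_integrable_div_one_add_pow hψ
  obtain ⟨C, hC, h⟩ := hF.exists_norm_comp_sub_two_smul_le M
  have hc := hF.1
  refine (hM.const_mul (C * (1 + ‖z‖) ^ M)).mono'
    ((aestronglyMeasurable_of_memLp_div_one_add_pow hψ).mul
      (Continuous.aestronglyMeasurable (by fun_prop))) (Eventually.of_forall fun w => ?_)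
  rw [norm_mul]
  calc _ ≤ ‖ψ w‖ * (C * (1 + ‖z‖) ^ M * ((1 + ‖w‖) ^ M)⁻¹) := by gcongr; exact h z w
    _ = _ := by ring

/-- This licenses Fubini. Of the M + l powers of decay of G, M cancel the growth in z of the bound
on F(z - 2w), and l make the rest integrable. -/
theorem integrable_prod_mul_comp_sub_two_smul_mul
    (hψ : MemLp (fun z => ψ z / (((1 + ‖z‖) ^ N : ℝ) : ℂ)) 2 volume)
    {F G : Phase n → ℂ} (hF : RapidDecay F) (hG : RapidDecay G) :
    Integrable (fun p : Phase n × Phase n => ψ p.2 * F (p.1 - (2 : ℝ) • p.2) * G p.1)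
      ((volume : Measure (Phase n)).prod volume) := by
  obtain ⟨M, hM⟩ := exists_integrable_div_one_add_pow hψ
  obtain ⟨C, hC, h⟩ := hF.exists_norm_comp_sub_two_smul_le M
  obtain ⟨l, hl⟩ := integrable_pow_neg_prod n
  obtain ⟨D, hD, h'⟩ := hG.2 (M + l)
  have hc := hF.1
  have hc' := hG.1
  refine (((hl l le_rfl).mul_prod hM).const_mul (C * D)).mono'
    (((aestronglyMeasurable_of_memLp_div_one_add_pow hψ).comp_snd.mul
      (Continuous.aestronglyMeasurable (by fun_prop))).mul
      (Continuous.aestronglyMeasurable (by fun_prop))) (Eventually.of_forall fun p => ?_)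
  rw [norm_mul, norm_mul]
  have hp : (1 + ‖p.1‖) ^ M ≠ 0 := by positivity
  calc _ ≤ ‖ψ p.2‖ * (C * (1 + ‖p.1‖) ^ M * ((1 + ‖p.2‖) ^ M)⁻¹) *
        (D * ((1 + ‖p.1‖) ^ (M + l))⁻¹) := by
        gcongr
        exacts [h p.1 p.2, h' p.1]
    _ = _ := by
        rw [pow_add, mul_inv]
        field_simp

variable {hbar τ ς : ℝ}

theorem rapidDecay_mixedGaussian (hh : 0 < hbar) (hτ : 0 < τ) (hς : 0 < ς) :
    RapidDecay (mixedGaussian (n := n) hbar τ ς) := by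
  rw [mixedGaussian_eq hh hτ hς]
  exact rapidDecay_fourierWigner hh.ne' _ _

/-- With c = û(-z), the Weyl integrand becomes a marginal of the joint integrand in (z, w). -/
theorem toeplitzSymbol_mul_eq (c : ℂ) (z : Phase n) :
    toeplitzSymbol hbar τ ς ψ z * c = ((hbar ^ (2 * n) : ℝ) : ℂ) *
      ∫ w, ψ w * mixedGaussian hbar τ ς (z - (2 : ℝ) • w) * c := by
  rw [toeplitzSymbol, mul_assoc, integral_mul_const]

theorem integrable_toeplitzSymbol_mul (hh : 0 < hbar) (hτ : 0 < τ) (hς : 0 < ς)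
    (hψ : MemLp (fun z => ψ z / (((1 + ‖z‖) ^ N : ℝ) : ℂ)) 2 volume) (f g : 𝓢(Config n, ℂ)) :
    Integrable (fun z : Phase n => toeplitzSymbol hbar τ ς ψ z *
      symplecticFourier hbar (schrodingerCoeff hbar f g) (-z)) := by
  simp only [toeplitzSymbol_mul_eq]
  exact (integrable_prod_mul_comp_sub_two_smul_mul hψ (rapidDecay_mixedGaussian hh hτ hς)
    (rapidDecay_symplecticFourier_schrodingerCoeff hh f g)).integral_prod_left.const_mul _

/-- The Weyl form of the symbol of a cross-Toeplitz operator. -/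
theorem weylForm_toeplitzSymbol (hh : 0 < hbar) (hτ : 0 < τ) (hς : 0 < ς)
    (hψ : MemLp (fun z => ψ z / (((1 + ‖z‖) ^ N : ℝ) : ℂ)) 2 volume) (f g : 𝓢(Config n, ℂ)) :
    weylForm hbar (toeplitzSymbol hbar τ ς ψ) f g =
      ∫ w, ψ w * (preFSB hbar τ f w * conj (preFSB hbar ς g w)) := by
  have hint := integrable_prod_mul_comp_sub_two_smul_mul hψ (rapidDecay_mixedGaussian hh hτ hς)
    (rapidDecay_symplecticFourier_schrodingerCoeff hh f g)
  simp only [weylForm, toeplitzSymbol_mul_eq]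
  rw [integral_const_mul, integral_integral_swap hint, ← integral_const_mul]
  refine integral_congr_ae (Eventually.of_forall fun w => ?_)
  simp only [mul_assoc (ψ w)]
  rw [integral_const_mul, integral_mixedGaussian_mul_symplecticFourier hh hτ hς]
  simp only [preFSB, map_mul, Complex.conj_ofReal]
  -- The ħ²ⁿ of the symbol and the ħ⁻ⁿ of Moyal's identity leave ħⁿ, the product of the
  -- normalisations of the two transforms.
  have hc : ((hbar ^ (2 * n) : ℝ) : ℂ) * (((hbar ^ n)⁻¹ : ℝ) : ℂ) =
      ((hbar ^ ((n : ℝ) / 2) : ℝ) : ℂ) * ((hbar ^ ((n : ℝ) / 2) : ℝ) : ℂ) := by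
    rw [← Complex.ofReal_mul, ← Complex.ofReal_mul, ← Real.rpow_add hh, add_halves,
      Real.rpow_natCast, two_mul, pow_add, mul_assoc, mul_inv_cancel₀ (by positivity), mul_one]
  rw [mul_left_comm, ← mul_assoc (((hbar ^ (2 * n) : ℝ) : ℂ)), hc]
  ring

/-! ### The cross-Toeplitz operator as a Weyl operator -/

theorem mem_crossToeplitz_domain (F : fsbSpace n hbar τ) :
    F ∈ (crossToeplitz n hbar τ ς ψ).domain ↔
      MemLp (fun z => ψ z * (F : L2Phase n) z) 2 volume := Iff.rfl

theorem preFSBEquiv_toLp_mem_domain (hh : 0 < hbar) (hτ : 0 < τ)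
    (hψ : MemLp (fun z => ψ z / (((1 + ‖z‖) ^ N : ℝ) : ℂ)) 2 volume) (φ : 𝓢(Config n, ℂ)) :
    preFSBEquiv n hh hτ (φ.toLp 2 volume) ∈ (crossToeplitz n hbar τ ς ψ).domain := by
  rw [mem_crossToeplitz_domain, coe_preFSBEquiv]
  refine ((rapidDecay_preFSB hh hτ φ).memLp_two_mul hψ).ae_eq ?_
  filter_upwards [preFSBCLM_ae_eq hh hτ (φ.toLp 2 volume)] with z hz
  rw [hz, preFSB_congr (φ.coeFn_toLp 2 volume)]

/-- After applying the unitary U_ς, the pairing is against an element of F_ς, where the orthogonal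
projection has no effect. -/
theorem inner_symm_crossToeplitz (hh : 0 < hbar) (hτ : 0 < τ) (hς : 0 < ς) (g f : L2Config n)
    (hf : preFSBEquiv n hh hτ f ∈ (crossToeplitz n hbar τ ς ψ).domain) :
    inner ℂ g ((preFSBEquiv n hh hς).symm
        (crossToeplitz n hbar τ ς ψ ⟨preFSBEquiv n hh hτ f, hf⟩)) =
      ∫ z, ψ z * (preFSBCLM n hh hτ f z * conj (preFSBCLM n hh hς g z)) := by
  rw [← (preFSBEquiv n hh hς).inner_map_map, LinearIsometryEquiv.apply_symm_apply]
  have h : inner ℂ (preFSBEquiv n hh hς g)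
      ((fsbSpace n hbar ς).orthogonalProjectionOnto
        (((mem_crossToeplitz_domain _).1 hf).toLp _)) =
      inner ℂ ((preFSBEquiv n hh hς g : fsbSpace n hbar ς) : L2Phase n)
        (((mem_crossToeplitz_domain _).1 hf).toLp _) :=
    Submodule.inner_orthogonalProjectionOnto_eq_of_mem_left _ _
  refine h.trans ?_
  rw [L2.inner_def]
  refine integral_congr_ae ?_
  filter_upwards [((mem_crossToeplitz_domain _).1 hf).coeFn_toLp] with z hz
  rw [hz, RCLike.inner_apply, coe_preFSBEquiv, coe_preFSBEquiv, mul_assoc]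

/-- Even for unbounded ψ the limit exists: U_ςg decays rapidly, so conj(ψ)U_ςg is in L², and the
Weyl form is the pairing of U_τφ with this fixed vector, hence L²-continuous in φ. -/
theorem isWeylPDO_crossToeplitz (hh : 0 < hbar) (hτ : 0 < τ) (hς : 0 < ς)
    (hψ : MemLp (fun z => ψ z / (((1 + ‖z‖) ^ N : ℝ) : ℂ)) 2 volume) (f : L2Config n)
    (hf : preFSBEquiv n hh hτ f ∈ (crossToeplitz n hbar τ ς ψ).domain) :
    IsWeylPDO hbar (toeplitzSymbol hbar τ ς ψ) f ((preFSBEquiv n hh hς).symm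
      (crossToeplitz n hbar τ ς ψ ⟨preFSBEquiv n hh hτ f, hf⟩)) := by
  intro g
  have hK : MemLp (fun z => conj (ψ z * conj (preFSB hbar ς g z))) 2 volume :=
    ((rapidDecay_preFSB hh hς g).conj.memLp_two_mul hψ).star
  have hinner : ∀ F : L2Phase n, inner ℂ (hK.toLp _) F =
      ∫ z, ψ z * (F z * conj (preFSB hbar ς g z)) := by
    intro F
    rw [L2.inner_def]
    refine integral_congr_ae ?_
    filter_upwards [hK.coeFn_toLp] with z hz
    rw [hz, RCLike.inner_apply, Complex.conj_conj, mul_left_comm]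
  have h1 : ∀ φ : 𝓢(Config n, ℂ), weylForm hbar (toeplitzSymbol hbar τ ς ψ) φ g =
      inner ℂ (hK.toLp _) (preFSBCLM n hh hτ (φ.toLp 2 volume)) := by
    intro φ
    rw [weylForm_toeplitzSymbol hh hτ hς hψ, hinner]
    refine integral_congr_ae ?_
    filter_upwards [preFSBCLM_ae_eq hh hτ (φ.toLp 2 volume)] with z hz
    rw [hz, preFSB_congr (φ.coeFn_toLp 2 volume)]
  have h2 : inner ℂ (g.toLp 2 volume) ((preFSBEquiv n hh hς).symm
      (crossToeplitz n hbar τ ς ψ ⟨preFSBEquiv n hh hτ f, hf⟩)) =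
      inner ℂ (hK.toLp _) (preFSBCLM n hh hτ f) := by
    rw [inner_symm_crossToeplitz, hinner]
    refine integral_congr_ae ?_
    filter_upwards [preFSBCLM_ae_eq hh hς (g.toLp 2 volume)] with z hz
    rw [hz, preFSB_congr (g.coeFn_toLp 2 volume)]
  rw [h2]
  simp only [h1]
  have hcont : Continuous fun F : L2Config n =>
      inner ℂ (hK.toLp _) (preFSBCLM n hh hτ F) := by fun_prop
  exact (hcont.tendsto f).comp tendsto_comap

end PolynomialGrowth

end

theorem mainTheorem6 (n : ℕ) (hbar τ ς : ℝ) (hhbar : 0 < hbar) (hτ : 0 < τ) (hς : 0 < ς)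
    (ψ : Phase n → ℂ)
    (hψ : ∃ N : ℕ, MemLp (fun z => ψ z / (((1 + ‖z‖) ^ N : ℝ) : ℂ)) 2 volume) :
    -- the mixed Gaussian in closed form
    (∀ x y : Config n, mixedGaussian hbar τ ς (x, y) =
      (((4 * τ * ς / (τ + ς) ^ 2) ^ ((n : ℝ) / 4) : ℝ) : ℂ) *
        Complex.exp (-(Real.pi * hbar / (τ + ς)) *
          (Complex.I * ((τ - ς : ℝ) : ℂ) * ((inner ℝ x y : ℝ) : ℂ) +
            ((‖x‖ ^ 2 + τ * ς * ‖y‖ ^ 2 : ℝ) : ℂ)))) ∧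
    -- the integrals defining the symbol and the form of the PDO converge absolutely
    (∀ z : Phase n, Integrable (fun w : Phase n =>
      ψ w * mixedGaussian hbar τ ς (z - (2 : ℝ) • w))) ∧
    (∀ f g : 𝓢(Config n, ℂ), Integrable (fun z : Phase n =>
      toeplitzSymbol hbar τ ς ψ z *
        symplecticFourier hbar (schrodingerCoeff hbar f g) (-z))) ∧
    -- the pre-FSB transforms are unitary and intertwine the two operators
    ∃ (Uτ : L2Config n ≃ₗᵢ[ℂ] fsbSpace n hbar τ) (Uς : L2Config n ≃ₗᵢ[ℂ] fsbSpace n hbar ς),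
      (∀ f : L2Config n, ((Uτ f : fsbSpace n hbar τ) : L2Phase n) =ᵐ[volume] preFSB hbar τ f) ∧
      (∀ f : L2Config n, ((Uς f : fsbSpace n hbar ς) : L2Phase n) =ᵐ[volume] preFSB hbar ς f) ∧
      (∀ φ : 𝓢(Config n, ℂ), Uτ (φ.toLp 2 volume) ∈ (crossToeplitz n hbar τ ς ψ).domain) ∧
      (∀ (f : L2Config n) (hf : Uτ f ∈ (crossToeplitz n hbar τ ς ψ).domain),
        IsWeylPDO hbar (toeplitzSymbol hbar τ ς ψ) f
          (Uς.symm (crossToeplitz n hbar τ ς ψ ⟨Uτ f, hf⟩))) := by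
  obtain ⟨N, hN⟩ := hψ
  exact ⟨mixedGaussian_closed_form hhbar hτ hς,
    integrable_mul_comp_sub_two_smul hN (rapidDecay_mixedGaussian hhbar hτ hς),
    integrable_toeplitzSymbol_mul hhbar hτ hς hN,
    preFSBEquiv n hhbar hτ, preFSBEquiv n hhbar hς,
    preFSBCLM_ae_eq hhbar hτ, preFSBCLM_ae_eq hhbar hς,
    preFSBEquiv_toLp_mem_domain hhbar hτ hN,
    isWeylPDO_crossToeplitz hhbar hτ hς hN⟩
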